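/- **Setting.** A metric tree $J$ is a simplicial tree (connected graph without circuits) with a positive length assigned to each edge; $\rho(a,b)$ denotes the sum of the lengths of the edges of the unique path joining the vertices $a,b$, and $d_{\rm symp}(a,b)$ the number of these edges. $J$ is *perfect* if every vertex belongs to at least $3$ edges, and *locally finite* if every vertex belongs to finitely many edges and all sets $\{b:\rho(a,b)<C\}$ are finite. Let $J$ be a locally finite perfect metric tree and fix a vertex $\xi$. The absolute ${\rm Abs}(J)$ is the set of rays (infinite sequences of distinct, successively adjacent vertices) modulo eventual coincidence up to a shift of the index. A branch $S$ is a subtree such that exactly one edge of $J$ joins a vertex $a$ of $S$ (the root) with a vertex outside $S$; the ball $B[S]\subset{\rm Abs}(J)$ is the set of points represented by rays in $S$. The balls generate the topology of ${\rm Abs}(J)$. A charge is a real-valued Borel measure of finite variation on ${\rm Abs}(J)$. For $0<\lambda<1$, let $\mathcal H_\lambda(J)$ be the real Hilbert space spanned by vectors $e_a$, $a\in{\rm Vert}(J)$, with $\langle e_a,e_b\rangle=\lambda^{\rho(a,b)}$, and put $f_a=\lambda^{-\rho(\xi,a)}e_a$. A finite subtree $R$ is *complete* if for each $a\in{\rm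 Vert}(R)$ either all vertices adjacent to $a$ lie in $R$ or exactly one does; $\partial R$ is the set of vertices of $R$ with an adjacent vertex outside $R$; we consider only $R$ with $\xi\in{\rm Vert}(R)\setminus\partial R$. For $u\in\partial R$ let $S_u$ be the unique branch with root $u$ not containing $\xi$, and for a charge $\mu$ put $$\Psi[\mu|R]=\sum_{u\in\partial R}\mu(B[S_u])\,f_u\in\mathcal H_\lambda(J).$$ The boundary space $\mathcal E_\lambda=\mathcal E_\lambda(J)$ is the set of all charges $\mu$ such that for every sequence $R_0\subset R_1\subset\dots$ of finite complete subtrees with $\bigcup_j R_j=J$ the limit $\lim_{j\to\infty}\|\Psi[\mu|R_j]\|_{\mathcal H_\lambda}$ exists and is finite. **Theorem 5.3.** There exists $\sigma\in[0,1]$ with the following properties. a) For $\lambda\in(0,1)$: $\mathcal E_\lambda=\{0\}$ if $\lambda<\sigma$, and $\mathcal E_\lambda\neq\{0\}$ if $\lambda>\sigma$. b) If the lengths of the edges of $J$ are bounded, then $\sigma<1$. c) Let $p\ge 1$ be an integer. If $J$ contains a subtree $I$ which is isomorphic, as a simplicial tree, to the Bruhat–Tits tree $\mathcal T_p$ (the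 tree in which each vertex belongs to exactly $p+1$ edges), and all edges of $I$ have length $\le\tau$, then $\sigma\le p^{-1/(2\tau)}$. d) If the lengths of the edges of $J$ are bounded below by a positive constant and there is a constant $\alpha$ such that, for all $N\in\{0,1,2,\dots\}$, the number of vertices $a$ with $d_{\rm symp}(\xi,a)\le N$ is at most $\exp(\alpha N)$, then $\sigma>0$. -/

import Mathlib

open scoped Topology InnerProductSpace

/-- A metric tree with vertex set `V`: a tree together with a positive length for every edge. -/
structure MetricTree (V : Type*) where
  /-- the underlying simplicial tree -/
  graph : SimpleGraph V
  isTree : graph.IsTree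
  /-- the length of an edge (only the values on `graph.edgeSet` are ever used) -/
  length : Sym2 V → ℝ
  length_pos : ∀ e ∈ graph.edgeSet, 0 < length e

namespace MetricTree

variable {V : Type*} (J : MetricTree V)

/-- The unique way (path without repeated vertices) connecting `a` and `b`. -/
noncomputable def path (a b : V) : J.graph.Walk a b :=
  (J.isTree.existsUnique_path a b).choose

theorem path_isPath (a b : V) : (J.path a b).IsPath :=
  (J.isTree.existsUnique_path a b).choose_spec.1

theorem path_unique {a b : V} (p : J.graph.Walk a b) (hp : p.IsPath) : p = J.path a b :=
  (J.isTree.existsUnique_path a b).unique hp (J.path_isPath a b)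

/-- The metric `ρ(a, b)`: the sum of the lengths of the edges of the way from `a` to `b`. -/
noncomputable def rho (a b : V) : ℝ := ((J.path a b).edges.map J.length).sum

/-- Every vertex belongs to at least three edges. -/
def IsPerfect : Prop := ∀ a, 3 ≤ (J.graph.neighborSet a).encard

/-- Every vertex belongs to finitely many edges, and all balls of the metric `ρ` are finite. -/
def IsLocallyFinite : Prop :=
  (∀ a, (J.graph.neighborSet a).Finite) ∧ ∀ a, ∀ C : ℝ, 0 < C → {b | J.rho a b < C}.Finite

/-! ### The Hilbert space spanned by the vertices -/

theorem rho_comm (a b : V) : J.rho a b = J.rho b a := by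
  have h := J.path_unique _ (J.path_isPath a b).reverse
  rw [rho, rho, ← h, SimpleGraph.Walk.edges_reverse, List.map_reverse, List.sum_reverse]

theorem rho_self (a : V) : J.rho a a = 0 := by
  have h := J.path_unique (SimpleGraph.Walk.nil : J.graph.Walk a a) (by simp)
  simp [rho, ← h]

open Classical in
/-- Removing an edge `e` from the tree, two vertices stay in the same component if and only if
`e` is not on the way between them. -/
theorem exists_separation (e : Sym2 V) : ∃ f : V → Set V,
    ∀ a b, f a = f b ↔ e ∉ (J.path a b).edges := by
  have key : ∀ a b, (∃ p : J.graph.Walk a b, e ∉ p.edges) ↔ e ∉ (J.path a b).edges := by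
    intro a b
    refine ⟨?_, fun h => ⟨_, h⟩⟩
    rintro ⟨p, hp⟩ h
    rw [← J.path_unique _ p.bypass_isPath] at h
    exact hp (p.edges_bypass_subset_edges h)
  refine ⟨fun a => {x | ∃ p : J.graph.Walk a x, e ∉ p.edges}, fun a b => ?_⟩
  rw [← key]
  constructor
  · intro h
    have hb : b ∈ {x | ∃ p : J.graph.Walk b x, e ∉ p.edges} := ⟨.nil, by simp⟩
    exact (Set.ext_iff.1 h b).2 hb
  · rintro ⟨p, hp⟩
    ext x
    constructor
    · rintro ⟨q, hq⟩
      exact ⟨p.reverse.append q, by simp [hp, hq]⟩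
    · rintro ⟨q, hq⟩
      exact ⟨p.append q, by simp [hp, hq]⟩

open Classical in
theorem edgeKernel_nonneg (r : Sym2 V → ℝ) (F : Finset (Sym2 V))
    (hr : ∀ e ∈ F, 0 ≤ r e ∧ r e ≤ 1) (s : Finset V) (c : V → ℝ) :
    0 ≤ ∑ a ∈ s, ∑ b ∈ s, c a * c b *
      ∏ e ∈ F, (if e ∈ (J.path a b).edges then r e else 1) := by
  induction F using Finset.induction_on generalizing c with
  | empty =>
    simp only [Finset.prod_empty, mul_one]
    rw [← Finset.sum_mul_sum]
    exact mul_self_nonneg _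
  | insert e F he ih =>
    obtain ⟨f, hf⟩ := J.exists_separation e
    have hr' : ∀ e ∈ F, 0 ≤ r e ∧ r e ≤ 1 := fun x hx => hr x (Finset.mem_insert_of_mem hx)
    obtain ⟨h0, h1⟩ := hr e (Finset.mem_insert_self _ _)
    set K : V → V → ℝ := fun a b => ∏ e ∈ F, (if e ∈ (J.path a b).edges then r e else 1)
    have hsplit : (∑ a ∈ s, ∑ b ∈ s, c a * c b *
        ∏ e ∈ insert e F, (if e ∈ (J.path a b).edges then r e else 1)) =
        r e * (∑ a ∈ s, ∑ b ∈ s, c a * c b * K a b) +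
        (1 - r e) * ∑ q ∈ s.image f, ∑ a ∈ s, ∑ b ∈ s,
          (if f a = q then c a else 0) * (if f b = q then c b else 0) * K a b := by
      have h2 : (∑ q ∈ s.image f, ∑ a ∈ s, ∑ b ∈ s,
          (if f a = q then c a else 0) * (if f b = q then c b else 0) * K a b) =
          ∑ a ∈ s, ∑ b ∈ s, (if f a = f b then c a * c b * K a b else 0) := by
        rw [Finset.sum_comm]
        refine Finset.sum_congr rfl fun a ha => ?_
        rw [Finset.sum_comm]
        refine Finset.sum_congr rfl fun b _ => ?_
        rw [Finset.sum_eq_single (f a)]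
        · by_cases h : f a = f b
          · simp [h]
          · simp [h, Ne.symm h]
        · intro q _ hq
          simp [Ne.symm hq]
        · intro h
          exact absurd (Finset.mem_image_of_mem f ha) h
      rw [h2, Finset.mul_sum, Finset.mul_sum, ← Finset.sum_add_distrib]
      refine Finset.sum_congr rfl fun a _ => ?_
      rw [Finset.mul_sum, Finset.mul_sum, ← Finset.sum_add_distrib]
      refine Finset.sum_congr rfl fun b _ => ?_
      rw [Finset.prod_insert he]
      change c a * c b * (_ * K a b) = _
      by_cases h : e ∈ (J.path a b).edges
      · have : f a ≠ f b := fun h' => (hf a b).1 h' h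
        simp only [h, this, if_true, if_false]
        ring
      · have : f a = f b := (hf a b).2 h
        simp only [h, this, if_true, if_false]
        ring
    rw [hsplit]
    refine add_nonneg (mul_nonneg h0 (ih hr' c)) (mul_nonneg (by linarith) ?_)
    exact Finset.sum_nonneg fun q _ => ih hr' (fun a => if f a = q then c a else 0)

open Classical in
/-- The kernel `(a, b) ↦ l ^ ρ(a, b)` is positive semidefinite. -/
theorem kernel_nonneg {l : ℝ} (h0 : 0 < l) (h1 : l < 1) (s : Finset V) (c : V → ℝ) :
    0 ≤ ∑ a ∈ s, ∑ b ∈ s, c a * c b * l ^ J.rho a b := by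
  let F : Finset (Sym2 V) := (s ×ˢ s).biUnion fun x => (J.path x.1 x.2).edges.toFinset
  have hF : ∀ e ∈ F, e ∈ J.graph.edgeSet := by
    intro e he
    obtain ⟨x, _, hx⟩ := Finset.mem_biUnion.1 he
    exact SimpleGraph.Walk.edges_subset_edgeSet _ (List.mem_toFinset.1 hx)
  have hr : ∀ e ∈ F, 0 ≤ l ^ J.length e ∧ l ^ J.length e ≤ 1 := fun e he =>
    ⟨(Real.rpow_pos_of_pos h0 _).le,
      Real.rpow_le_one h0.le h1.le (J.length_pos e (hF e he)).le⟩
  refine (J.edgeKernel_nonneg (fun e => l ^ J.length e) F hr s c).trans_eq ?_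
  refine Finset.sum_congr rfl fun a ha => Finset.sum_congr rfl fun b hb => ?_
  congr 1
  have hnd : (J.path a b).edges.Nodup := (J.path_isPath a b).isTrail.edges_nodup
  have hsub : (J.path a b).edges.toFinset ⊆ F := by
    intro e he
    exact Finset.mem_biUnion.2 ⟨(a, b), Finset.mem_product.2 ⟨ha, hb⟩, he⟩
  rw [rho, ← List.sum_toFinset _ hnd, Real.rpow_sum_of_pos h0]
  rw [← Finset.prod_subset hsub]
  · exact Finset.prod_congr rfl fun e he => by rw [if_pos (List.mem_toFinset.1 he)]
  · intro e _ he
    rw [if_neg (fun h => he (List.mem_toFinset.2 h))]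

/-- The bilinear form `∑ f a * g b * l ^ ρ(a, b)` on finite formal combinations of vertices. -/
noncomputable def gram (l : ℝ) (f g : V →₀ ℝ) : ℝ :=
  f.sum fun a x => g.sum fun b y => x * y * l ^ J.rho a b

/-- Finite formal linear combinations of the vertices, to be equipped with the inner product
`⟪e a, e b⟫ = l ^ ρ(a, b)`. -/
def FormalVec (_J : MetricTree V) (_l : Set.Ioo (0 : ℝ) 1) : Type _ := V →₀ ℝ

noncomputable instance (l : Set.Ioo (0 : ℝ) 1) : AddCommGroup (FormalVec J l) :=
  inferInstanceAs (AddCommGroup (V →₀ ℝ))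

noncomputable instance (l : Set.Ioo (0 : ℝ) 1) : Module ℝ (FormalVec J l) :=
  inferInstanceAs (Module ℝ (V →₀ ℝ))

theorem gram_comm (l : ℝ) (f g : V →₀ ℝ) : J.gram l f g = J.gram l g f := by
  rw [gram, gram, Finsupp.sum_comm]
  simp only [J.rho_comm, mul_comm]

theorem gram_add_left (l : ℝ) (f g h : V →₀ ℝ) :
    J.gram l (f + g) h = J.gram l f h + J.gram l g h := by
  rw [gram, gram, gram, Finsupp.sum_add_index'] <;> simp [← Finsupp.sum_add, add_mul]

theorem gram_smul_left (l r : ℝ) (f g : V →₀ ℝ) : J.gram l (r • f) g = r * J.gram l f g := by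
  rw [gram, gram, Finsupp.sum_smul_index] <;> simp [Finsupp.mul_sum, mul_assoc]

noncomputable instance formalVecCore (l : Set.Ioo (0 : ℝ) 1) :
    PreInnerProductSpace.Core ℝ (FormalVec J l) where
  inner f g := J.gram l f g
  conj_inner_symm f g := J.gram_comm l g f
  re_inner_nonneg f :=
    J.kernel_nonneg l.2.1 l.2.2 (Finsupp.support (M := ℝ) f) (DFunLike.coe (F := V →₀ ℝ) f)
  add_left f g h := J.gram_add_left l f g h
  smul_left f g r := J.gram_smul_left l r f g

noncomputable instance (l : Set.Ioo (0 : ℝ) 1) : SeminormedAddCommGroup (FormalVec J l) :=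
  InnerProductSpace.Core.toSeminormedAddCommGroup (𝕜 := ℝ)

noncomputable instance (l : Set.Ioo (0 : ℝ) 1) : InnerProductSpace ℝ (FormalVec J l) :=
  .ofCore _

/-- The real Hilbert space `H_l(J)` spanned by formal vectors `e a`, `a ∈ V`, with inner products
`⟪e a, e b⟫ = l ^ ρ(a, b)`. -/
abbrev H (l : Set.Ioo (0 : ℝ) 1) : Type _ := UniformSpace.Completion (FormalVec J l)

/-- The spanning vectors `e a`. -/
noncomputable def e (l : Set.Ioo (0 : ℝ) 1) (a : V) : J.H l :=
  ((show FormalVec J l from (Finsupp.single a (1 : ℝ) : V →₀ ℝ)) : J.H l)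

theorem inner_e (l : Set.Ioo (0 : ℝ) 1) (a b : V) :
    ⟪J.e l a, J.e l b⟫_ℝ = (l : ℝ) ^ J.rho a b := by
  refine (UniformSpace.Completion.inner_coe (𝕜 := ℝ) _ _).trans ?_
  change J.gram l (Finsupp.single a 1) (Finsupp.single b 1) = _
  simp [gram]

/-- The rescaled vectors `f a = l ^ (-ρ(ξ, a)) e a`. -/
noncomputable def f (ξ : V) (l : Set.Ioo (0 : ℝ) 1) (a : V) : J.H l :=
  ((l : ℝ) ^ (-J.rho ξ a)) • J.e l a

/-! ### The absolute -/

/-- A ray: an infinite way `a 0, a 1, …` of distinct vertices. -/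
def Ray : Type _ :=
  {a : ℕ → V // Function.Injective a ∧ ∀ n, J.graph.Adj (a n) (a (n + 1))}

/-- Two rays are equivalent if they eventually coincide up to a shift of the index. -/
def raySetoid : Setoid J.Ray where
  r a b := ∃ m n, ∀ j, a.1 (m + j) = b.1 (n + j)
  iseqv :=
    { refl := fun _ => ⟨0, 0, fun _ => rfl⟩
      symm := fun ⟨m, n, h⟩ => ⟨n, m, fun j => (h j).symm⟩
      trans := by
        rintro a b c ⟨m, n, h⟩ ⟨n', k, h'⟩
        refine ⟨m + n', k + n, fun j => ?_⟩
        have h1 := h (n' + j)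
        have h2 := h' (n + j)
        rw [show m + n' + j = m + (n' + j) by ring, h1,
          show n + (n' + j) = n' + (n + j) by ring, h2, show k + (n + j) = k + n + j by ring] }

/-- The absolute of `J`: the set of classes of equivalent rays. -/
def Abs : Type _ := Quotient J.raySetoid

/-- `S` is (the vertex set of) a branch with root `a`: a subtree such that exactly one edge of `J`
joins a vertex of `S` with a vertex outside `S`, and `a` is the end of this edge in `S`. -/
def IsBranch (S : Set V) (a : V) : Prop :=
  (J.graph.induce S).Connected ∧ ∃ b, (a ∈ S ∧ b ∉ S ∧ J.graph.Adj a b) ∧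
    ∀ a' b', a' ∈ S → b' ∉ S → J.graph.Adj a' b' → a' = a ∧ b' = b

/-- The absolute of the subtree with vertex set `S`, as a subset of `Abs J`; for a branch `S` this
is the ball `B[S]`. -/
def ball (S : Set V) : Set J.Abs :=
  {ω | ∃ r : J.Ray, Quotient.mk J.raySetoid r = ω ∧ ∀ n, r.1 n ∈ S}

/-- The topology generated by the balls `B[S]`. (The complement of a ball is a ball, so that the
balls are open and closed.) -/
instance : TopologicalSpace J.Abs :=
  TopologicalSpace.generateFrom {B | ∃ S a, J.IsBranch S a ∧ B = J.ball S}

instance : MeasurableSpace J.Abs := borel _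

instance : BorelSpace J.Abs := ⟨rfl⟩

/-- A charge on the absolute: a real-valued (hence finite variation) Borel measure. -/
abbrev Charge : Type _ := MeasureTheory.SignedMeasure J.Abs

/-! ### Complete subtrees and approximations of charges -/

/-- `R` is (the vertex set of) a finite complete subtree, and `ξ ∈ R \ ∂R`. Complete means: for
every vertex of `R`, either all adjacent vertices are in `R` or exactly one of them is. -/
def IsCompleteSubtree (ξ : V) (R : Finset V) : Prop :=
  (J.graph.induce (R : Set V)).Connected ∧
  (∀ a ∈ R, (∀ b, J.graph.Adj a b → b ∈ R) ∨ ∃! b, J.graph.Adj a b ∧ b ∈ R) ∧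
  ξ ∈ R ∧ ∀ b, J.graph.Adj ξ b → b ∈ R

open Classical in
/-- The boundary `∂R`: the vertices of `R` having an adjacent vertex outside `R`. -/
noncomputable def boundary (R : Finset V) : Finset V :=
  R.filter fun a => ∃ b, J.graph.Adj a b ∧ b ∉ R

/-- The vertices `x` such that `u` lies on the way from `ξ` to `x`. For `u ≠ ξ` this is the branch
`S_u` with root `u` that does not contain `ξ`, see `isBranch_iff`. -/
def outerBranch (ξ u : V) : Set V := {x | u ∈ (J.path ξ x).support}

open Classical in
/-- For `u ≠ ξ`, `outerBranch ξ u` is the unique branch with root `u` not containing `ξ`. -/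
theorem isBranch_iff {ξ u : V} (hu : u ≠ ξ) (S : Set V) :
    (J.IsBranch S u ∧ ξ ∉ S) ↔ S = J.outerBranch ξ u := by
  constructor
  · rintro ⟨⟨-, b, ⟨huS, hbS, hub⟩, huniq⟩, hξ⟩
    ext x
    constructor
    · intro hx
      obtain ⟨d, hd, h1, h2⟩ := (J.path ξ x).exists_boundary_dart Sᶜ hξ (by simpa using hx)
      have h3 := huniq d.snd d.fst (by simpa using h2) h1 d.adj.symm
      have := SimpleGraph.Walk.dart_snd_mem_support_of_mem_darts _ hd
      rw [h3.1] at this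
      exact this
    · intro hx
      by_contra hxS
      have hx' : u ∈ (J.path ξ x).support := hx
      obtain ⟨d, hd, h1, h2⟩ :=
        ((J.path ξ x).takeUntil u hx').exists_boundary_dart Sᶜ hξ (by simpa using huS)
      obtain ⟨d', hd', h1', h2'⟩ :=
        ((J.path ξ x).dropUntil u hx').exists_boundary_dart S huS hxS
      have h3 := huniq d.snd d.fst (by simpa using h2) h1 d.adj.symm
      have h3' := huniq d'.fst d'.snd h1' h2' d'.adj
      have hnd := (J.path_isPath ξ x).isTrail.edges_nodup
      rw [← (J.path ξ x).take_spec hx', SimpleGraph.Walk.edges_append,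
        List.nodup_append] at hnd
      refine hnd.2.2 d.edge (List.mem_map.2 ⟨d, hd, rfl⟩) d'.edge
        (List.mem_map.2 ⟨d', hd', rfl⟩) ?_
      rw [SimpleGraph.Dart.edge, SimpleGraph.Dart.edge]
      rw [h3.1, h3.2, h3'.1, h3'.2, Sym2.eq_swap]
  · rintro rfl
    have huu : u ∈ J.outerBranch ξ u := SimpleGraph.Walk.end_mem_support _
    have hξ : ξ ∉ J.outerBranch ξ u := by
      intro h
      have h' : u ∈ (J.path ξ ξ).support := h
      rw [← J.path_unique (SimpleGraph.Walk.nil : J.graph.Walk ξ ξ) (by simp)] at h'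
      simp [hu] at h'
    have htake : ∀ x y (hy : y ∈ (J.path ξ x).support),
        (J.path ξ x).takeUntil y hy = J.path ξ y := fun x y hy =>
      J.path_unique _ ((J.path_isPath ξ x).takeUntil hy)
    have hcross : ∀ a' b', a' ∈ J.outerBranch ξ u → b' ∉ J.outerBranch ξ u →
        J.graph.Adj a' b' → a' = u ∧ b' = (J.path ξ u).penultimate := by
      intro a' b' ha hb hab
      have hnot : a' ∉ (J.path ξ b').support := by
        intro h
        apply hb
        have ha' : u ∈ (J.path ξ a').support := ha
        rw [← htake b' a' h] at ha'
        exact SimpleGraph.Walk.support_takeUntil_subset_support _ h ha'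
      have hc := J.path_unique _ ((J.path_isPath ξ b').concat hnot hab.symm)
      have ha' : u ∈ (J.path ξ a').support := ha
      rw [← hc, SimpleGraph.Walk.support_concat] at ha'
      have hua : u = a' := by
        rcases (by simpa using ha' : u ∈ (J.path ξ b').support ∨ u = a') with h | h
        · exact absurd h hb
        · exact h
      subst hua
      refine ⟨rfl, ?_⟩
      rw [← hc]
      simp
    refine ⟨⟨?_, ?_⟩, hξ⟩
    · rw [SimpleGraph.connected_iff_exists_forall_reachable]
      refine ⟨⟨u, huu⟩, fun ⟨x, hx⟩ => ?_⟩
      have hx' : u ∈ (J.path ξ x).support := hx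
      have h : ∀ y ∈ ((J.path ξ x).dropUntil u hx').support, y ∈ J.outerBranch ξ u := by
        intro y hy
        have hp := J.path_isPath ξ x
        rw [← (J.path ξ x).take_spec hx', ← ((J.path ξ x).dropUntil u hx').take_spec hy,
          SimpleGraph.Walk.append_assoc] at hp
        have hq := J.path_unique _ hp.of_append_left
        change u ∈ (J.path ξ y).support
        rw [← hq, SimpleGraph.Walk.mem_support_append_iff]
        exact Or.inl (SimpleGraph.Walk.end_mem_support _)
      exact (((J.path ξ x).dropUntil u hx').induce (J.outerBranch ξ u) h).reachable
    · obtain ⟨d, hd, h1, h2⟩ :=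
        (J.path ξ u).exists_boundary_dart (J.outerBranch ξ u)ᶜ hξ (by simpa using huu)
      have h3 := hcross d.snd d.fst (by simpa using h2) h1 d.adj.symm
      refine ⟨(J.path ξ u).penultimate, ⟨huu, ?_, ?_⟩, hcross⟩
      · rw [← h3.2]; exact h1
      · have := d.adj.symm
        rwa [h3.1, h3.2] at this

/-- The vector `Ψ[μ|R] = ∑_{u ∈ ∂R} μ(B[S_u]) f_u`. -/
noncomputable def Psi (ξ : V) (l : Set.Ioo (0 : ℝ) 1) (μ : J.Charge) (R : Finset V) : J.H l :=
  ∑ u ∈ J.boundary R, μ (J.ball (J.outerBranch ξ u)) • J.f ξ l u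

/-- `R 0 ⊆ R 1 ⊆ …` are finite complete subtrees whose union is `J`. -/
def IsExhaustion (ξ : V) (R : ℕ → Finset V) : Prop :=
  Monotone R ∧ (∀ j, J.IsCompleteSubtree ξ (R j)) ∧ ∀ a, ∃ j, a ∈ R j

/-- The boundary space `E_l(J)`: all charges `μ` of finite variation on the absolute such that
`‖Ψ[μ|R_j]‖` has a finite limit for exhaustions `R_0 ⊆ R_1 ⊆ …` of `J`. -/
def boundarySpace (ξ : V) (l : Set.Ioo (0 : ℝ) 1) : Set J.Charge :=
  {μ | ∀ R : ℕ → Finset V, J.IsExhaustion ξ R →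
    ∃ c : ℝ, Filter.Tendsto (fun j => ‖J.Psi ξ l μ (R j)‖) Filter.atTop (𝓝 c)}

end MetricTree

/-- The Bruhat–Tits tree `T_p`: the tree in which every vertex belongs to `p + 1` edges. -/
def IsBruhatTitsTree {W : Type*} (p : ℕ) (G : SimpleGraph W) : Prop :=
  G.IsTree ∧ ∀ v, (G.neighborSet v).encard = p + 1

/-!
Write `B_a` for the ball `B[S_a]` (the whole absolute for `a = ξ`), and let the weight of a vertex
`a ≠ ξ` with parent `a'` be `w_l(a) = l ^ (-2 ρ(ξ, a)) - l ^ (-2 ρ(ξ, a'))`, with `w_l(ξ) = 1`.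

The inner product of `f_u` and `f_v` is `l ^ (-2 x)` with `x` the length of the common part of the
ways from `ξ` to `u` and `v`, which telescopes to the sum of `w_l(a)` over the common ancestors `a`
of `u` and `v` (`rpow_rho_eq_sum_weight`). The boundary of a complete subtree `R` cuts every ray
from `ξ` exactly once, so that `μ(B_a)` is the sum of `μ(B_u)` over the `u ∈ ∂R` beyond `a`
(`charge_ball_eq_sum_boundary`). Together,
`‖Ψ[μ|R]‖² = ∑_{a ∈ R} w_l(a) μ(B_a)²` (`norm_Psi_sq`),
which increases with `R`. Hence `μ` lies in the boundary space if and only if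
`∑_a w_l(a) μ(B_a)² < ∞` (`mem_boundarySpace_iff`). As the weights decrease in `l`, the boundary
spaces increase with `l`, and `σ` is the infimum of the `l` whose boundary space is nontrivial.

* If every vertex of `I` has `p` children in `I` along edges of length at most `τ`, consider the
  random ray that starts at a vertex of `I` and chooses each time one of `p` children uniformly. Its
  distribution charges `B_a` with at most `p ^ (-k)` if `a` lies `k` levels below the start, and the
  weights there are `O(l ^ (-2 τ k))`, so that the series is dominated by a geometric one when
  `l ^ (-2 τ) < p` (`HasChildren.boundarySpace_ne`). A Bruhat-Tits subtree has `p` children at each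
  vertex wherever `ξ` lies, and a perfect tree has two; this bounds `σ` from above.
* If edges have length at least `δ`, the weights of level `N` are at least of the order
  `l ^ (-2 δ N)`. With at most `exp (α N)` vertices on this level, the Cauchy-Schwarz inequality
  forces `∑ |μ(B_a)|` over the level to tend to `0` when `l ^ (2 δ) exp α < 1`; thus all `μ(B_a)`
  vanish (`boundarySpace_eq_zero`), and `μ = 0` because the balls are a π-system generating the Borel
  sets (`charge_eq_zero`).
-/

namespace MetricTree

variable {V : Type*} (J : MetricTree V)

/-! ### Rooted tree structure -/

theorem path_self (a : V) : J.path a a = SimpleGraph.Walk.nil :=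
  (J.path_unique _ (by simp)).symm

theorem path_eq_concat {a b c : V} (h : J.graph.Adj b c) (hc : c ∉ (J.path a b).support) :
    J.path a c = (J.path a b).concat h :=
  (J.path_unique _ ((J.path_isPath a b).concat hc h)).symm

theorem rho_eq_add {a b c : V} (h : J.graph.Adj b c) (hc : c ∉ (J.path a b).support) :
    J.rho a c = J.rho a b + J.length s(b, c) := by
  rw [rho, J.path_eq_concat h hc, rho]
  simp [SimpleGraph.Walk.edges_concat]

/-- The number of edges on the way from the root `ξ` to `u`. -/
noncomputable def level (ξ u : V) : ℕ := (J.path ξ u).length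

/-- The neighbour of `u` on the way to the root `ξ`; the parent of `ξ` is `ξ` itself. -/
noncomputable def parent (ξ u : V) : V := (J.path ξ u).penultimate

theorem level_self (ξ : V) : J.level ξ ξ = 0 := by simp [level, path_self]

theorem eq_of_level_eq_zero {ξ u : V} (h : J.level ξ u = 0) : u = ξ :=
  (SimpleGraph.Walk.eq_of_length_eq_zero h).symm

theorem parent_of_notMem {ξ a b : V} (h : J.graph.Adj a b) (hb : b ∉ (J.path ξ a).support) :
    J.parent ξ b = a := by
  rw [parent, J.path_eq_concat h hb]
  simp

theorem level_of_notMem {ξ a b : V} (h : J.graph.Adj a b) (hb : b ∉ (J.path ξ a).support) :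
    J.level ξ b = J.level ξ a + 1 := by
  rw [level, J.path_eq_concat h hb, level]
  simp

theorem level_le_of_mem {ξ a u : V} (h : a ∈ (J.path ξ u).support) :
    J.level ξ a ≤ J.level ξ u := by
  classical
  rw [level, ← J.path_unique _ ((J.path_isPath ξ u).takeUntil h)]
  exact SimpleGraph.Walk.length_takeUntil_le_length _ h

theorem level_ne_of_adj {ξ a b : V} (h : J.graph.Adj a b) : J.level ξ a ≠ J.level ξ b := by
  by_cases hb : b ∈ (J.path ξ a).support
  · by_cases ha : a ∈ (J.path ξ b).support
    · classical
      have h1 := J.path_unique _ ((J.path_isPath ξ a).takeUntil hb)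
      intro he
      have h2 : ((J.path ξ a).takeUntil b hb).length < (J.path ξ a).length :=
        SimpleGraph.Walk.length_takeUntil_lt_length hb h.ne'
      rw [h1] at h2
      exact absurd he (Nat.ne_of_gt h2)
    · have := J.level_of_notMem h.symm ha
      omega
  · have := J.level_of_notMem h hb
    omega

theorem adj_cases (ξ : V) {a b : V} (h : J.graph.Adj a b) :
    (b ∉ (J.path ξ a).support) ∨ (a ∉ (J.path ξ b).support) := by
  by_contra! hc
  exact J.level_ne_of_adj h (le_antisymm (J.level_le_of_mem hc.2) (J.level_le_of_mem hc.1))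

theorem parent_cases (ξ : V) {a b : V} (h : J.graph.Adj a b) :
    (J.parent ξ b = a ∧ J.level ξ b = J.level ξ a + 1) ∨
      (J.parent ξ a = b ∧ J.level ξ a = J.level ξ b + 1) :=
  (J.adj_cases ξ h).imp (fun hb => ⟨J.parent_of_notMem h hb, J.level_of_notMem h hb⟩)
    (fun hb => ⟨J.parent_of_notMem h.symm hb, J.level_of_notMem h.symm hb⟩)

theorem parent_adj {ξ u : V} (hu : u ≠ ξ) : J.graph.Adj (J.parent ξ u) u :=
  SimpleGraph.Walk.adj_penultimate (SimpleGraph.Walk.not_nil_of_ne hu.symm)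

theorem parent_self (ξ : V) : J.parent ξ ξ = ξ := by simp [parent, path_self]

theorem notMem_path_parent {ξ u : V} (hu : u ≠ ξ) :
    u ∉ (J.path ξ (J.parent ξ u)).support :=
  (J.adj_cases ξ (J.parent_adj hu)).resolve_right
    fun h => h (SimpleGraph.Walk.getVert_mem_support _ _)

theorem level_parent {ξ u : V} (hu : u ≠ ξ) : J.level ξ u = J.level ξ (J.parent ξ u) + 1 :=
  J.level_of_notMem (J.parent_adj hu) (J.notMem_path_parent hu)

theorem level_iterate_parent (ξ u : V) (k : ℕ) :
    J.level ξ ((J.parent ξ)^[k] u) = J.level ξ u - k := by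
  induction k with
  | zero => simp
  | succ k ih =>
    rw [Function.iterate_succ_apply']
    by_cases h : (J.parent ξ)^[k] u = ξ
    · rw [h, parent_self, level_self]
      rw [h, level_self] at ih
      omega
    · have := J.level_parent h
      omega

theorem mem_path_iff {ξ u a : V} (hu : u ≠ ξ) :
    a ∈ (J.path ξ u).support ↔ a ∈ (J.path ξ (J.parent ξ u)).support ∨ a = u := by
  rw [J.path_eq_concat (J.parent_adj hu) (J.notMem_path_parent hu)]
  simp [SimpleGraph.Walk.support_concat]

theorem rho_parent {ξ u : V} (hu : u ≠ ξ) :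
    J.rho ξ u = J.rho ξ (J.parent ξ u) + J.length s(J.parent ξ u, u) :=
  J.rho_eq_add (J.parent_adj hu) (J.notMem_path_parent hu)

theorem eq_of_mem_of_level_le {ξ a u : V} (h : a ∈ (J.path ξ u).support)
    (hl : J.level ξ u ≤ J.level ξ a) : a = u := by
  by_cases hu : u = ξ
  · subst hu; simpa [path_self] using h
  · rcases (J.mem_path_iff hu).1 h with h | h
    · have := J.level_le_of_mem h
      have := J.level_parent hu
      omega
    · exact h

theorem rho_nonneg (a b : V) : 0 ≤ J.rho a b := by
  refine List.sum_nonneg fun x hx => ?_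
  obtain ⟨e, he, rfl⟩ := List.mem_map.1 hx
  exact (J.length_pos e (SimpleGraph.Walk.edges_subset_edgeSet _ he)).le

/-- Seen from a vertex that is not a descendant of `u`, the way to `u` runs through its parent. -/
theorem notMem_path_parent_of_notMem {ξ u v : V} (hu : u ≠ ξ) (hv : u ∉ (J.path ξ v).support) :
    u ∉ (J.path v (J.parent ξ u)).support := by
  classical
  intro h
  rw [← J.path_unique _ ((J.path ξ v).reverse.append (J.path ξ (J.parent ξ u))).bypass_isPath] at h
  have := SimpleGraph.Walk.support_bypass_subset_support _ h
  rw [SimpleGraph.Walk.mem_support_append_iff, SimpleGraph.Walk.support_reverse,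
    List.mem_reverse] at this
  exact this.elim hv (J.notMem_path_parent hu)

theorem rho_eq_rho_parent_add {ξ u v : V} (hu : u ≠ ξ) (hv : u ∉ (J.path ξ v).support) :
    J.rho v u = J.rho v (J.parent ξ u) + J.length s(J.parent ξ u, u) :=
  J.rho_eq_add (J.parent_adj hu) (J.notMem_path_parent_of_notMem hu hv)

theorem level_eq_dist (ξ u : V) : J.level ξ u = J.graph.dist ξ u := by
  obtain ⟨p, hp, hl⟩ := J.isTree.connected.exists_path_of_dist ξ u
  rw [level, ← J.path_unique p hp, hl]

theorem mem_path_of_iterate (ξ u : V) (k : ℕ) :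
    (J.parent ξ)^[k] u ∈ (J.path ξ u).support := by
  induction k generalizing u with
  | zero => simp
  | succ k ih =>
    rw [Function.iterate_succ_apply]
    by_cases hu : u = ξ
    · subst hu
      simpa only [parent_self] using ih u
    · exact (J.mem_path_iff hu).2 (Or.inl (ih _))

theorem iterate_of_mem_path {ξ a u : V} (h : a ∈ (J.path ξ u).support) :
    (J.parent ξ)^[J.level ξ u - J.level ξ a] u = a := by
  induction hn : J.level ξ u - J.level ξ a generalizing u with
  | zero => exact (J.eq_of_mem_of_level_le h (by omega)).symm
  | succ n ih =>
    have hu : u ≠ ξ := by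
      rintro rfl
      rw [level_self] at hn; omega
    have hl := J.level_parent hu
    rw [Function.iterate_succ_apply]
    refine ih ?_ (by omega)
    rcases (J.mem_path_iff hu).1 h with h | h
    · exact h
    · subst h; omega

/-! ### Finite sets of vertices -/

theorem IsLocallyFinite.countable {J : MetricTree V} (hJ : J.IsLocallyFinite) (ξ : V) :
    Countable V := by
  rw [← Set.countable_univ_iff]
  have : (Set.univ : Set V) = ⋃ n : ℕ, {b | J.rho ξ b < (n : ℝ) + 1} := by
    ext b
    obtain ⟨n, hn⟩ := exists_nat_gt (J.rho ξ b)
    simp only [Set.mem_univ, Set.mem_iUnion, Set.mem_ofPred_eq, true_iff]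
    exact ⟨n, by linarith⟩
  rw [this]
  exact Set.countable_iUnion fun n => (hJ.2 ξ _ (by positivity)).countable

theorem IsLocallyFinite.finite_level_le {J : MetricTree V} (hJ : J.IsLocallyFinite) (ξ : V)
    (n : ℕ) : {a | J.level ξ a ≤ n}.Finite := by
  induction n with
  | zero =>
    refine (Set.finite_singleton ξ).subset fun a ha => ?_
    exact J.eq_of_level_eq_zero (Nat.le_zero.1 ha)
  | succ n ih =>
    refine ((Set.finite_singleton ξ).union (ih.biUnion fun a _ => hJ.1 a)).subset fun a ha => ?_
    by_cases h : a = ξ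
    · exact Or.inl h
    · refine Or.inr (Set.mem_biUnion (x := J.parent ξ a) ?_ (J.parent_adj h))
      have := J.level_parent h
      have ha' : J.level ξ a ≤ n + 1 := ha
      change J.level ξ (J.parent ξ a) ≤ n
      omega

theorem mem_of_mem_path_of_connected {S : Set V} (hS : (J.graph.induce S).Connected) {x y a : V}
    (hx : x ∈ S) (hy : y ∈ S) (ha : a ∈ (J.path x y).support) : a ∈ S := by
  classical
  obtain ⟨p⟩ := hS.preconnected ⟨x, hx⟩ ⟨y, hy⟩
  have hq : ∀ z ∈ (p.map (SimpleGraph.Embedding.induce S).toHom).support, z ∈ S := by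
    intro z hz
    rw [SimpleGraph.Walk.support_map, List.mem_map] at hz
    obtain ⟨w, -, rfl⟩ := hz
    exact w.2
  rw [← J.path_unique (a := x) (b := y) _ (SimpleGraph.Walk.bypass_isPath
    (p.map (SimpleGraph.Embedding.induce S).toHom))] at ha
  exact hq a (SimpleGraph.Walk.support_bypass_subset_support _ ha)

/-- The balls around `ξ` for the edge-counting distance are complete subtrees. -/
theorem isCompleteSubtree_of_level {ξ : V} {R : Finset V} {n : ℕ}
    (hR : ∀ a, a ∈ R ↔ J.level ξ a ≤ n + 1) : J.IsCompleteSubtree ξ R := by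
  have hξ : ξ ∈ R := by rw [hR, level_self]; omega
  refine ⟨?_, fun a ha => ?_, hξ, fun b hb => ?_⟩
  · rw [SimpleGraph.connected_iff_exists_forall_reachable]
    refine ⟨⟨ξ, hξ⟩, fun ⟨x, hx⟩ => ?_⟩
    have h : ∀ y ∈ (J.path ξ x).support, y ∈ (R : Set V) := fun y hy =>
      (hR y).2 ((J.level_le_of_mem hy).trans ((hR x).1 hx))
    exact ((J.path ξ x).induce (R : Set V) h).reachable
  · rcases Nat.lt_or_ge (J.level ξ a) (n + 1) with h | h
    · left
      intro b hb
      rw [hR]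
      rcases J.parent_cases ξ hb with h1 | h1 <;> omega
    · right
      have ha' : a ≠ ξ := by
        rintro rfl
        rw [level_self] at h; omega
      refine ⟨J.parent ξ a, ⟨(J.parent_adj ha').symm, ?_⟩, fun b hb => ?_⟩
      · have := J.level_parent ha'
        have := (hR a).1 ha
        rw [hR]; omega
      · have := (hR b).1 hb.2
        rcases J.parent_cases ξ hb.1 with h1 | h1
        · omega
        · exact h1.1.symm
  · rw [hR]
    have := J.level_self ξ
    rcases J.parent_cases ξ hb with h1 | h1 <;> omega

theorem IsLocallyFinite.exists_exhaustion {J : MetricTree V} (hJ : J.IsLocallyFinite) (ξ : V) :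
    ∃ R, J.IsExhaustion ξ R := by
  refine ⟨fun n => (hJ.finite_level_le ξ (n + 1)).toFinset, fun m n h a ha => ?_,
    fun n => J.isCompleteSubtree_of_level (n := n) (by simp), fun a => ⟨J.level ξ a, by simp⟩⟩
  simp only [Set.Finite.mem_toFinset, Set.mem_ofPred_eq] at ha ⊢
  omega

/-! ### Rays issuing from the root -/

/-- The sequence `s` moves away from the root `ξ`: each term is the parent of the next one. -/
def IsOutward (ξ : V) (s : ℕ → V) : Prop :=
  ∀ n, s (n + 1) ≠ ξ ∧ J.parent ξ (s (n + 1)) = s n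

namespace IsOutward

variable {J} {ξ : V} {s : ℕ → V}

theorem level_eq (hs : J.IsOutward ξ s) (n : ℕ) : J.level ξ (s n) = J.level ξ (s 0) + n := by
  induction n with
  | zero => rfl
  | succ n ih =>
    rw [J.level_parent (hs n).1, (hs n).2, ih]
    omega

theorem adj (hs : J.IsOutward ξ s) (n : ℕ) : J.graph.Adj (s n) (s (n + 1)) := by
  have := J.parent_adj (hs n).1
  rwa [(hs n).2] at this

theorem injective (hs : J.IsOutward ξ s) : Function.Injective s := by
  intro m n h
  have h1 := hs.level_eq m
  have h2 := hs.level_eq n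
  rw [h] at h1
  omega

theorem iterate_parent (hs : J.IsOutward ξ s) (n k : ℕ) :
    (J.parent ξ)^[k] (s (n + k)) = s n := by
  induction k with
  | zero => rfl
  | succ k ih => rw [Function.iterate_succ_apply, ← add_assoc, (hs _).2, ih]

theorem comp_add (hs : J.IsOutward ξ s) (m : ℕ) : J.IsOutward ξ fun n => s (m + n) :=
  fun n => hs (m + n)

/-- The ray given by an outward sequence. -/
def toRay (hs : J.IsOutward ξ s) : J.Ray := ⟨s, hs.injective, hs.adj⟩

/-- Outward sequences that eventually coincide up to a shift coincide wherever their levels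
agree. -/
theorem eq_of_eventually {t : ℕ → V} (hs : J.IsOutward ξ s) (hs0 : s 0 = ξ)
    (ht : J.IsOutward ξ t) {m n : ℕ} (h : ∀ j, s (m + j) = t (n + j)) (k : ℕ) :
    s (J.level ξ (t 0) + k) = t k := by
  have h1 := hs.level_eq m
  have h2 := ht.level_eq n
  have h3 := h 0
  rw [add_zero, add_zero] at h3
  rw [h3, hs0, level_self] at h1
  have h4 := h k
  have hm : m + k = J.level ξ (t 0) + k + n := by omega
  rw [hm, add_comm n k] at h4
  rw [← hs.iterate_parent _ n, h4, ht.iterate_parent]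

theorem mem_path_iff (hs : J.IsOutward ξ s) (hs0 : s 0 = ξ) {a : V} {n : ℕ} :
    a ∈ (J.path ξ (s n)).support ↔ J.level ξ a ≤ n ∧ s (J.level ξ a) = a := by
  have hl : ∀ k, J.level ξ (s k) = k := fun k => by rw [hs.level_eq, hs0, level_self, zero_add]
  constructor
  · intro h
    have h1 := J.level_le_of_mem h
    have h2 := J.iterate_of_mem_path h
    rw [hl] at h1 h2
    refine ⟨h1, ?_⟩
    have h3 := hs.iterate_parent (J.level ξ a) (n - J.level ξ a)
    rw [Nat.add_sub_cancel' h1, h2] at h3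
    exact h3.symm
  · rintro ⟨h1, h2⟩
    have h3 := hs.iterate_parent (J.level ξ a) (n - J.level ξ a)
    rw [Nat.add_sub_cancel' h1, h2] at h3
    nth_rewrite 1 [← h3]
    exact J.mem_path_of_iterate _ _ _

end IsOutward

/-- A ray can approach the root only finitely often, and afterwards it moves outward. -/
theorem exists_isOutward_tail (ξ : V) (r : J.Ray) : ∃ N, J.IsOutward ξ fun n => r.1 (N + n) := by
  have hstep : ∃ N, J.parent ξ (r.1 (N + 1)) = r.1 N ∧
      J.level ξ (r.1 (N + 1)) = J.level ξ (r.1 N) + 1 := by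
    by_contra! hc
    have h : ∀ n, J.level ξ (r.1 n) + n = J.level ξ (r.1 0) := by
      intro n
      induction n with
      | zero => rfl
      | succ n ih =>
        rcases J.parent_cases ξ (r.2.2 n) with h | h
        · exact absurd h.2 (hc n h.1)
        · omega
    have := h (J.level ξ (r.1 0) + 1)
    omega
  obtain ⟨N, hN⟩ := hstep
  refine ⟨N, fun n => ?_⟩
  have h : J.parent ξ (r.1 (N + n + 1)) = r.1 (N + n) ∧
      J.level ξ (r.1 (N + n + 1)) = J.level ξ (r.1 (N + n)) + 1 := by
    induction n with
    | zero => exact hN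
    | succ n ih =>
      rcases J.parent_cases ξ (r.2.2 (N + n + 1)) with h | h
      · exact h
      · -- the ray would have to turn back along the edge it came from
        have := r.2.1 (h.1.symm.trans ih.1)
        omega
  refine ⟨fun h0 => ?_, h.1⟩
  have h2 := h.2
  have h0' : r.1 (N + n + 1) = ξ := h0
  rw [h0', level_self] at h2
  omega

theorem exists_rootRay (ξ : V) (r : J.Ray) :
    ∃ s : ℕ → V, s 0 = ξ ∧ J.IsOutward ξ s ∧ ∃ m n, ∀ j, s (m + j) = r.1 (n + j) := by
  obtain ⟨N, hN⟩ := J.exists_isOutward_tail ξ r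
  set L := J.level ξ (r.1 N)
  have hl : ∀ n, J.level ξ (r.1 (N + n)) = L + n := fun n => hN.level_eq n
  refine ⟨fun k => (J.parent ξ)^[L] (r.1 (N + k)), ?_, fun k => ⟨?_, ?_⟩, L, N, fun j => ?_⟩
  · apply J.eq_of_level_eq_zero
    rw [level_iterate_parent, hl]
    omega
  · intro h
    change (J.parent ξ)^[L] (r.1 (N + (k + 1))) = ξ at h
    have := J.level_iterate_parent ξ (r.1 (N + (k + 1))) L
    rw [h, level_self, hl] at this
    omega
  · change J.parent ξ ((J.parent ξ)^[L] (r.1 (N + (k + 1)))) = (J.parent ξ)^[L] (r.1 (N + k))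
    exact (Function.iterate_succ_apply' (J.parent ξ) L _).symm.trans
      ((Function.iterate_succ_apply (J.parent ξ) L _).trans (congrArg _ (hN k).2))
  · have := hN.iterate_parent j L
    rwa [add_comm j L] at this

/-- The vertices of the unique ray from `ξ` representing the point `ω` of the absolute. -/
noncomputable def rootRay (ξ : V) (ω : J.Abs) : ℕ → V :=
  (J.exists_rootRay ξ (Quotient.out ω)).choose

theorem rootRay_zero (ξ : V) (ω : J.Abs) : J.rootRay ξ ω 0 = ξ :=
  (J.exists_rootRay ξ (Quotient.out ω)).choose_spec.1

theorem rootRay_isOutward (ξ : V) (ω : J.Abs) : J.IsOutward ξ (J.rootRay ξ ω) :=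
  (J.exists_rootRay ξ (Quotient.out ω)).choose_spec.2.1

theorem level_rootRay (ξ : V) (ω : J.Abs) (n : ℕ) : J.level ξ (J.rootRay ξ ω n) = n := by
  rw [(J.rootRay_isOutward ξ ω).level_eq, rootRay_zero, level_self, zero_add]

theorem mk_rootRay (ξ : V) (ω : J.Abs) :
    Quotient.mk J.raySetoid (J.rootRay_isOutward ξ ω).toRay = ω := by
  conv_rhs => rw [← Quotient.out_eq ω]
  exact Quotient.sound (J.exists_rootRay ξ (Quotient.out ω)).choose_spec.2.2

theorem exists_rootRay_mk (ξ : V) (r : J.Ray) :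
    ∃ m n, ∀ j, J.rootRay ξ (Quotient.mk J.raySetoid r) (m + j) = r.1 (n + j) :=
  Quotient.exact (J.mk_rootRay ξ (Quotient.mk J.raySetoid r))

theorem rootRay_mk {ξ : V} (r : J.Ray) (hr : J.IsOutward ξ r.1) (k : ℕ) :
    J.rootRay ξ (Quotient.mk J.raySetoid r) (J.level ξ (r.1 0) + k) = r.1 k := by
  obtain ⟨m, n, h⟩ := J.exists_rootRay_mk ξ r
  exact (J.rootRay_isOutward ξ _).eq_of_eventually (J.rootRay_zero ξ _) hr h k

/-! ### Balls and Borel sets of the absolute -/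

theorem rootRay_mem_outerBranch {ξ u : V} {ω : J.Abs} {n : ℕ} :
    J.rootRay ξ ω n ∈ J.outerBranch ξ u ↔ J.level ξ u ≤ n ∧ J.rootRay ξ ω (J.level ξ u) = u :=
  (J.rootRay_isOutward ξ ω).mem_path_iff (J.rootRay_zero ξ ω)

theorem mem_ball_outerBranch {ξ u : V} {ω : J.Abs} :
    ω ∈ J.ball (J.outerBranch ξ u) ↔ J.rootRay ξ ω (J.level ξ u) = u := by
  constructor
  · rintro ⟨r, rfl, hr⟩
    obtain ⟨m, n, h⟩ := J.exists_rootRay_mk ξ r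
    have h1 := hr (n + 0)
    rw [← h] at h1
    exact (J.rootRay_mem_outerBranch.1 h1).2
  · intro h
    refine ⟨((J.rootRay_isOutward ξ ω).comp_add (J.level ξ u)).toRay, ?_, fun n => ?_⟩
    · conv_rhs => rw [← J.mk_rootRay ξ ω]
      exact Quotient.sound ⟨0, J.level ξ u, fun j => by simp [IsOutward.toRay]⟩
    · exact J.rootRay_mem_outerBranch.2 ⟨Nat.le_add_right _ _, h⟩

theorem mem_ball_compl_outerBranch {ξ u : V} {ω : J.Abs} :
    ω ∈ J.ball (J.outerBranch ξ u)ᶜ ↔ J.rootRay ξ ω (J.level ξ u) ≠ u := by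
  constructor
  · rintro ⟨r, rfl, hr⟩ hω
    obtain ⟨m, n, h⟩ := J.exists_rootRay_mk ξ r
    refine hr (n + J.level ξ u) ?_
    rw [← h]
    exact J.rootRay_mem_outerBranch.2 ⟨by omega, hω⟩
  · intro h
    exact ⟨_, J.mk_rootRay ξ ω, fun n hn => h (J.rootRay_mem_outerBranch.1 hn).2⟩

theorem ball_outerBranch_self (ξ : V) : J.ball (J.outerBranch ξ ξ) = Set.univ := by
  ext ω
  simp [mem_ball_outerBranch, level_self, rootRay_zero]

/-- A branch containing `ξ` is the complement of a branch not containing it. -/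
theorem IsBranch.eq_outerBranch_or_compl {J : MetricTree V} {S : Set V} {a : V}
    (hS : J.IsBranch S a) (ξ : V) : ∃ u, S = J.outerBranch ξ u ∨ S = (J.outerBranch ξ u)ᶜ := by
  classical
  by_cases hξ : ξ ∈ S
  · obtain ⟨hconn, b, ⟨haS, hbS, hab⟩, huniq⟩ := hS
    refine ⟨b, Or.inr ?_⟩
    ext x
    constructor
    · intro hx hxb
      exact hbS (J.mem_of_mem_path_of_connected hconn hξ hx hxb)
    · intro hx
      by_contra hxS
      obtain ⟨d, hd, h1, h2⟩ := (J.path ξ x).exists_boundary_dart S hξ hxS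
      have h3 := huniq d.fst d.snd h1 h2 d.adj
      have := SimpleGraph.Walk.dart_snd_mem_support_of_mem_darts _ hd
      rw [h3.2] at this
      exact hx this
  · have haξ : a ≠ ξ := by
      obtain ⟨-, b, ⟨haS, -⟩, -⟩ := hS
      rintro rfl
      exact hξ haS
    exact ⟨a, Or.inl ((J.isBranch_iff haξ S).1 ⟨hS, hξ⟩)⟩

theorem ball_compl_outerBranch (ξ u : V) :
    J.ball (J.outerBranch ξ u)ᶜ = (J.ball (J.outerBranch ξ u))ᶜ := by
  ext ω
  rw [mem_ball_compl_outerBranch, Set.mem_compl_iff, mem_ball_outerBranch]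

theorem isOpen_ball_outerBranch (ξ u : V) : IsOpen (J.ball (J.outerBranch ξ u)) := by
  by_cases hu : u = ξ
  · rw [hu, ball_outerBranch_self]
    exact isOpen_univ
  · exact TopologicalSpace.isOpen_generateFrom_of_mem
      ⟨_, u, ((J.isBranch_iff hu _).2 rfl).1, rfl⟩

theorem measurableSet_ball_outerBranch (ξ u : V) : MeasurableSet (J.ball (J.outerBranch ξ u)) :=
  (J.isOpen_ball_outerBranch ξ u).measurableSet

/-- The balls `B[S_u]` generate the Borel sets of the absolute, since there are only countably
many of them. -/
theorem borel_eq_generateFrom_ball [Countable V] (ξ : V) :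
    (inferInstance : MeasurableSpace J.Abs) =
      MeasurableSpace.generateFrom (Set.range fun u => J.ball (J.outerBranch ξ u)) := by
  have hsub : {B | ∃ S a, J.IsBranch S a ∧ B = J.ball S} ⊆
      (Set.range fun u => J.ball (J.outerBranch ξ u)) ∪
        (Set.range fun u => (J.ball (J.outerBranch ξ u))ᶜ) := by
    rintro B ⟨S, a, hS, rfl⟩
    obtain ⟨u, rfl | rfl⟩ := hS.eq_outerBranch_or_compl ξ
    · exact Or.inl ⟨u, rfl⟩
    · exact Or.inr ⟨u, (J.ball_compl_outerBranch ξ u).symm⟩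
  have : SecondCountableTopology J.Abs :=
    ⟨⟨{B | ∃ S a, J.IsBranch S a ∧ B = J.ball S},
      ((Set.countable_range _).union (Set.countable_range _)).mono hsub, rfl⟩⟩
  apply le_antisymm
  · change borel J.Abs ≤ _
    rw [borel_eq_generateFrom_of_subbasis (s := {B | ∃ S a, J.IsBranch S a ∧ B = J.ball S}) rfl]
    refine MeasurableSpace.generateFrom_le fun B hB => ?_
    rcases hsub hB with ⟨u, rfl⟩ | ⟨u, rfl⟩
    · exact MeasurableSpace.measurableSet_generateFrom (Set.mem_range_self u)
    · exact (MeasurableSpace.measurableSet_generateFrom (Set.mem_range_self u)).compl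
  · refine MeasurableSpace.generateFrom_le ?_
    rintro _ ⟨u, rfl⟩
    exact J.measurableSet_ball_outerBranch ξ u

theorem ball_outerBranch_subset {ξ a u : V} (h : a ∈ (J.path ξ u).support) :
    J.ball (J.outerBranch ξ u) ⊆ J.ball (J.outerBranch ξ a) := by
  intro ω hω
  rw [mem_ball_outerBranch] at hω ⊢
  have : J.rootRay ξ ω (J.level ξ u) ∈ J.outerBranch ξ a := by rwa [hω]
  exact (J.rootRay_mem_outerBranch.1 this).2

theorem mem_path_of_mem_ball {ξ a u : V} {ω : J.Abs} (ha : ω ∈ J.ball (J.outerBranch ξ a))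
    (hu : ω ∈ J.ball (J.outerBranch ξ u)) (h : J.level ξ a ≤ J.level ξ u) :
    a ∈ (J.path ξ u).support := by
  rw [mem_ball_outerBranch] at ha hu
  rw [← hu]
  exact J.rootRay_mem_outerBranch.2 ⟨h, ha⟩

theorem isPiSystem_ball (ξ : V) : IsPiSystem (Set.range fun u => J.ball (J.outerBranch ξ u)) := by
  rintro _ ⟨a, rfl⟩ _ ⟨u, rfl⟩ ⟨ω, ha, hu⟩
  rcases le_total (J.level ξ a) (J.level ξ u) with h | h
  · exact ⟨u, (Set.inter_eq_self_of_subset_right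
      (J.ball_outerBranch_subset (J.mem_path_of_mem_ball ha hu h))).symm⟩
  · exact ⟨a, (Set.inter_eq_self_of_subset_left
      (J.ball_outerBranch_subset (J.mem_path_of_mem_ball hu ha h))).symm⟩

/-- A charge is determined by its values on the balls `B[S_u]`. -/
theorem charge_eq_zero [Countable V] (ξ : V) {μ : J.Charge}
    (h : ∀ u, μ (J.ball (J.outerBranch ξ u)) = 0) : μ = 0 := by
  refine MeasureTheory.VectorMeasure.ext_of_generateFrom _ ?_ (J.borel_eq_generateFrom_ball ξ)
    (J.isPiSystem_ball ξ) ?_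
  · rintro _ ⟨u, rfl⟩
    rw [h]; rfl
  · have := h ξ
    rw [ball_outerBranch_self] at this
    rw [this]; rfl

open Classical in
/-- If every ray from `ξ` through `a` meets the finite set `F` of descendants of `a` exactly once,
then `B[S_a]` is the disjoint union of the balls `B[S_u]`, `u ∈ F`. -/
theorem charge_ball_eq_sum {ξ a : V} (μ : J.Charge) (F : Finset V)
    (hF : ∀ u ∈ F, a ∈ (J.path ξ u).support)
    (h : ∀ ω ∈ J.ball (J.outerBranch ξ a), ∃! u, u ∈ F ∧ ω ∈ J.ball (J.outerBranch ξ u)) :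
    μ (J.ball (J.outerBranch ξ a)) = ∑ u ∈ F, μ (J.ball (J.outerBranch ξ u)) := by
  rw [← MeasureTheory.VectorMeasure.of_biUnion_finset]
  · congr 1
    ext ω
    rw [Set.mem_iUnion₂]
    constructor
    · intro hω
      obtain ⟨u, ⟨h1, h2⟩, -⟩ := h ω hω
      exact ⟨u, h1, h2⟩
    · rintro ⟨u, h1, h2⟩
      exact J.ball_outerBranch_subset (hF u h1) h2
  · intro u hu v hv huv
    refine Set.disjoint_left.2 fun ω h1 h2 => huv ?_
    exact (h ω (J.ball_outerBranch_subset (hF u hu) h1)).unique ⟨hu, h1⟩ ⟨hv, h2⟩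
  · exact fun u _ => J.measurableSet_ball_outerBranch ξ u

open Classical in
/-- The boundary of a complete subtree cuts every ray from the root exactly once. -/
theorem charge_ball_eq_sum_boundary {ξ a : V} (μ : J.Charge) {R : Finset V}
    (hR : J.IsCompleteSubtree ξ R) (ha : a ∈ R) :
    μ (J.ball (J.outerBranch ξ a)) =
      ∑ u ∈ (J.boundary R).filter (fun u => a ∈ (J.path ξ u).support),
        μ (J.ball (J.outerBranch ξ u)) := by
  refine J.charge_ball_eq_sum μ _ (fun u hu => (Finset.mem_filter.1 hu).2) fun ω hω => ?_
  set s := J.rootRay ξ ω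
  have hs : J.IsOutward ξ s := J.rootRay_isOutward ξ ω
  have hs0 : s 0 = ξ := J.rootRay_zero ξ ω
  have hdown : ∀ m n, m ≤ n → s n ∈ R → s m ∈ R := by
    intro m n hmn hn
    refine J.mem_of_mem_path_of_connected hR.1 hR.2.2.1 hn ((hs.mem_path_iff hs0).2 ?_)
    rw [J.level_rootRay]
    exact ⟨hmn, rfl⟩
  have hex : ∃ n, s n ∉ R := by
    by_contra! hc
    exact Set.infinite_range_of_injective hs.injective
      (R.finite_toSet.subset (by rintro _ ⟨n, rfl⟩; exact hc n))
  obtain ⟨N, hN⟩ : ∃ N, ∀ n, s n ∈ R ↔ n ≤ N := by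
    have h0 : Nat.find hex ≠ 0 := by
      intro h
      have := Nat.find_spec hex
      rw [h, hs0] at this
      exact this hR.2.2.1
    refine ⟨Nat.find hex - 1, fun n => ⟨fun hn => ?_, fun hn => ?_⟩⟩
    · by_contra hlt
      exact Nat.find_spec hex (hdown _ n (by omega) hn)
    · by_contra hn'
      have := Nat.find_min' hex hn'
      omega
  have hla : s (J.level ξ a) = a := J.mem_ball_outerBranch.1 hω
  refine ⟨s N, ⟨Finset.mem_filter.2 ⟨Finset.mem_filter.2 ⟨(hN N).2 le_rfl, s (N + 1),
    hs.adj N, ?_⟩, ?_⟩, ?_⟩, ?_⟩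
  · rw [hN]; omega
  · exact (hs.mem_path_iff hs0).2 ⟨(hN _).1 (by rwa [hla]), hla⟩
  · rw [mem_ball_outerBranch, J.level_rootRay]
  · rintro u ⟨hu, hωu⟩
    obtain ⟨huR, b, hub, hb⟩ := Finset.mem_filter.1 (Finset.mem_filter.1 hu).1
    have hlu : s (J.level ξ u) = u := J.mem_ball_outerBranch.1 hωu
    generalize J.level ξ u = n at hlu
    subst hlu
    have hn := (hN n).1 huR
    rcases hn.eq_or_lt with rfl | hlt
    · rfl
    · exfalso
      rcases hR.2.1 _ huR with hall | ⟨c, -, hc⟩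
      · exact hb (hall b hub)
      · have h1 := hc _ ⟨hs.adj n, (hN _).2 hlt⟩
        rcases Nat.eq_zero_or_pos n with rfl | hpos
        · rw [hs0] at hub
          exact hb (hR.2.2.2 b hub)
        · obtain ⟨m, rfl⟩ : ∃ m, n = m + 1 := ⟨n - 1, by omega⟩
          have h2 := hc _ ⟨(hs.adj m).symm, (hN _).2 (by omega)⟩
          have := hs.injective (h1.trans h2.symm)
          omega

/-! ### The norm of the approximations of a charge -/

open Classical in
/-- The increment of the function `a ↦ l ^ (-2 ρ(ξ, a))` along the edge from the parent of `a`
to `a`; at the root it is the value `1` of this function. -/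
noncomputable def weight (ξ : V) (l : ℝ) (a : V) : ℝ :=
  if a = ξ then 1 else l ^ (-2 * J.rho ξ a) - l ^ (-2 * J.rho ξ (J.parent ξ a))

theorem length_parent_pos {ξ a : V} (ha : a ≠ ξ) : 0 < J.length s(J.parent ξ a, a) :=
  J.length_pos _ ((SimpleGraph.mem_edgeSet _).2 (J.parent_adj ha))

theorem weight_nonneg (ξ : V) {l : ℝ} (h0 : 0 < l) (h1 : l < 1) (a : V) :
    0 ≤ J.weight ξ l a := by
  rw [weight]
  split_ifs with h
  · exact zero_le_one
  · rw [sub_nonneg]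
    apply Real.rpow_le_rpow_of_exponent_ge h0 h1.le
    have := J.rho_parent h
    have := J.length_parent_pos h
    linarith

theorem weight_le (ξ : V) {l : ℝ} (h0 : 0 < l) (a : V) :
    J.weight ξ l a ≤ l ^ (-2 * J.rho ξ a) := by
  rw [weight]
  split_ifs with h
  · rw [h, rho_self]; simp
  · linarith [Real.rpow_pos_of_pos h0 (-2 * J.rho ξ (J.parent ξ a))]

theorem weight_eq {ξ : V} {l : ℝ} (h0 : 0 < l) {a : V} (ha : a ≠ ξ) :
    J.weight ξ l a = l ^ (-2 * J.rho ξ a) * (1 - l ^ (2 * J.length s(J.parent ξ a, a))) := by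
  rw [weight, if_neg ha, mul_sub, mul_one, ← Real.rpow_add h0, J.rho_parent ha]
  congr 2
  ring

/-- The weights decrease in `l`, because so does `t ^ y - t ^ x` for `0 ≤ x ≤ y` with
`t = l⁻²`. -/
theorem weight_anti (ξ : V) {l m : ℝ} (h0 : 0 < l) (hlm : l ≤ m) (h1 : m < 1) (a : V) :
    J.weight ξ m a ≤ J.weight ξ l a := by
  have hm : 0 < m := h0.trans_le hlm
  by_cases ha : a = ξ
  · simp [weight, ha]
  · rw [J.weight_eq h0 ha, J.weight_eq hm ha]
    have hlen := J.length_parent_pos ha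
    have hr := J.rho_nonneg ξ a
    apply mul_le_mul
    · exact Real.rpow_le_rpow_of_nonpos h0 hlm (by linarith)
    · exact sub_le_sub_left (Real.rpow_le_rpow h0.le hlm (by linarith)) _
    · rw [sub_nonneg]
      exact Real.rpow_le_one hm.le h1.le (by linarith)
    · exact (Real.rpow_pos_of_pos h0 _).le

open Classical in
/-- Inner products of the vectors `f_u` as sums over common ancestors: going one step up from the
lower of two distinct vertices changes neither their common ancestors nor their Gromov product. -/
theorem rpow_rho_eq_sum_weight (ξ : V) (l : ℝ) (u v : V) :
    l ^ (J.rho u v - J.rho ξ u - J.rho ξ v) =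
      ∑ a ∈ (J.path ξ u).support.toFinset ∩ (J.path ξ v).support.toFinset, J.weight ξ l a := by
  induction hn : J.level ξ u + J.level ξ v using Nat.strong_induction_on generalizing u v with
  | _ n ih =>
  have hsupp : ∀ w, w ≠ ξ → (J.path ξ w).support.toFinset =
      insert w (J.path ξ (J.parent ξ w)).support.toFinset := by
    intro w hw
    ext a
    simp only [List.mem_toFinset, Finset.mem_insert, J.mem_path_iff hw, or_comm]
  have hlt : ∀ u v, u ≠ v → J.level ξ u + J.level ξ v = n → J.level ξ v ≤ J.level ξ u →
      l ^ (J.rho u v - J.rho ξ u - J.rho ξ v) =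
      ∑ a ∈ (J.path ξ u).support.toFinset ∩ (J.path ξ v).support.toFinset,
        J.weight ξ l a := by
    intro u v huv hn hl
    have hv : u ∉ (J.path ξ v).support := fun h => huv (J.eq_of_mem_of_level_le h hl)
    have hu : u ≠ ξ := by
      rintro rfl
      exact hv (SimpleGraph.Walk.start_mem_support _)
    have hlev := J.level_parent hu
    rw [hsupp u hu, Finset.insert_inter_of_notMem (by simpa using hv),
      ← ih _ (by omega) (J.parent ξ u) v rfl, J.rho_parent hu, J.rho_comm u v,
      J.rho_eq_rho_parent_add hu hv, J.rho_comm v]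
    congr 1
    ring
  by_cases huv : u = v
  · subst huv
    rw [Finset.inter_self, rho_self]
    by_cases hu : u = ξ
    · subst hu
      simp [path_self, rho_self, weight]
    · have hlev := J.level_parent hu
      have h := ih _ (by omega) (J.parent ξ u) (J.parent ξ u) rfl
      rw [Finset.inter_self, rho_self] at h
      rw [hsupp u hu, Finset.sum_insert (by simpa using J.notMem_path_parent hu), ← h, weight,
        if_neg hu]
      ring_nf
  · rcases le_total (J.level ξ v) (J.level ξ u) with h | h
    · exact hlt u v huv hn h
    · rw [Finset.inter_comm, ← hlt v u (Ne.symm huv) (by omega) h, J.rho_comm]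
      congr 1
      ring

theorem inner_f (ξ : V) (l : Set.Ioo (0 : ℝ) 1) (u v : V) :
    ⟪J.f ξ l u, J.f ξ l v⟫_ℝ = (l : ℝ) ^ (J.rho u v - J.rho ξ u - J.rho ξ v) := by
  rw [f, f, real_inner_smul_left, real_inner_smul_right, inner_e, ← Real.rpow_add l.2.1,
    ← Real.rpow_add l.2.1]
  congr 1
  ring

open Classical in
/-- The squared norm of `Ψ[μ|R]` is a sum of nonnegative terms over the vertices of `R`. -/
theorem norm_Psi_sq (ξ : V) (l : Set.Ioo (0 : ℝ) 1) (μ : J.Charge) {R : Finset V}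
    (hR : J.IsCompleteSubtree ξ R) :
    ‖J.Psi ξ l μ R‖ ^ 2 =
      ∑ a ∈ R, J.weight ξ l a * μ (J.ball (J.outerBranch ξ a)) ^ 2 := by
  set m : V → ℝ := fun u => μ (J.ball (J.outerBranch ξ u)) with hm
  have hterm : ∀ u ∈ J.boundary R, ∀ v, (l : ℝ) ^ (J.rho u v - J.rho ξ u - J.rho ξ v) =
      ∑ a ∈ R, (if a ∈ (J.path ξ u).support then 1 else 0) *
        (if a ∈ (J.path ξ v).support then 1 else 0) * J.weight ξ l a := by
    intro u hu v
    rw [J.rpow_rho_eq_sum_weight ξ l]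
    have hsub : (J.path ξ u).support.toFinset ∩ (J.path ξ v).support.toFinset ⊆ R := by
      intro a ha
      exact J.mem_of_mem_path_of_connected hR.1 hR.2.2.1 (Finset.mem_filter.1 hu).1
        (List.mem_toFinset.1 (Finset.mem_inter.1 ha).1)
    rw [← Finset.sum_subset hsub]
    · refine Finset.sum_congr rfl fun a ha => ?_
      rw [Finset.mem_inter, List.mem_toFinset, List.mem_toFinset] at ha
      simp [ha.1, ha.2]
    · intro a _ ha
      rw [Finset.mem_inter, List.mem_toFinset, List.mem_toFinset, not_and_or] at ha
      rcases ha with ha | ha <;> simp [ha]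
  have hball : ∀ a ∈ R, m a =
      ∑ u ∈ J.boundary R, (if a ∈ (J.path ξ u).support then 1 else 0) * m u := by
    intro a ha
    rw [hm]
    beta_reduce
    rw [J.charge_ball_eq_sum_boundary μ hR ha, Finset.sum_filter]
    refine Finset.sum_congr rfl fun u _ => ?_
    split_ifs <;> simp
  rw [← real_inner_self_eq_norm_sq, Psi, sum_inner]
  calc ∑ u ∈ J.boundary R, ⟪m u • J.f ξ l u, ∑ v ∈ J.boundary R, m v • J.f ξ l v⟫_ℝ
      = ∑ u ∈ J.boundary R, ∑ v ∈ J.boundary R, ∑ a ∈ R,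
          J.weight ξ l a * (((if a ∈ (J.path ξ u).support then 1 else 0) * m u) *
            ((if a ∈ (J.path ξ v).support then 1 else 0) * m v)) := by
        refine Finset.sum_congr rfl fun u hu => ?_
        rw [inner_sum]
        refine Finset.sum_congr rfl fun v _ => ?_
        rw [real_inner_smul_left, real_inner_smul_right, inner_f, hterm u hu v, Finset.mul_sum,
          Finset.mul_sum]
        refine Finset.sum_congr rfl fun a _ => ?_
        ring
    _ = ∑ a ∈ R, J.weight ξ l a * m a ^ 2 := by
        rw [Finset.sum_congr rfl fun u _ => Finset.sum_comm, Finset.sum_comm]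
        refine Finset.sum_congr rfl fun a ha => ?_
        rw [sq, hball a ha, Finset.sum_mul_sum, Finset.mul_sum]
        refine Finset.sum_congr rfl fun u _ => ?_
        rw [Finset.mul_sum]

/-- Membership in the boundary space as a summability condition. -/
theorem mem_boundarySpace_iff (hJ : J.IsLocallyFinite) (ξ : V) (l : Set.Ioo (0 : ℝ) 1)
    (μ : J.Charge) : μ ∈ J.boundarySpace ξ l ↔
      Summable fun a => J.weight ξ l a * μ (J.ball (J.outerBranch ξ a)) ^ 2 := by
  have hnn : ∀ a, 0 ≤ J.weight ξ l a * μ (J.ball (J.outerBranch ξ a)) ^ 2 := fun a =>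
    mul_nonneg (J.weight_nonneg ξ l.2.1 l.2.2 a) (sq_nonneg _)
  constructor
  · intro h
    obtain ⟨R, hR⟩ := hJ.exists_exhaustion ξ
    obtain ⟨c, hc⟩ := h R hR
    have hc2 := hc.pow 2
    simp only [J.norm_Psi_sq ξ l μ (hR.2.1 _)] at hc2
    have hmono : Monotone fun j =>
        ∑ a ∈ R j, J.weight ξ l a * μ (J.ball (J.outerBranch ξ a)) ^ 2 := fun i j hij =>
      Finset.sum_le_sum_of_subset_of_nonneg (hR.1 hij) fun a _ _ => hnn a
    refine summable_of_sum_le hnn (c := c ^ 2) fun F => ?_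
    have hF : ∃ j, F ⊆ R j := by
      choose j hj using hR.2.2
      exact ⟨F.sup j, fun a ha => hR.1 (Finset.le_sup ha) (hj a)⟩
    obtain ⟨j, hj⟩ := hF
    exact (Finset.sum_le_sum_of_subset_of_nonneg hj fun a _ _ => hnn a).trans
      (hmono.ge_of_tendsto hc2 j)
  · intro h R hR
    have htends : Filter.Tendsto R Filter.atTop Filter.atTop :=
      Filter.tendsto_atTop_finset_of_monotone hR.1 hR.2.2
    refine ⟨√(∑' a, J.weight ξ l a * μ (J.ball (J.outerBranch ξ a)) ^ 2), ?_⟩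
    have := (h.hasSum.comp htends).sqrt
    refine this.congr fun j => ?_
    rw [Function.comp_apply, ← J.norm_Psi_sq ξ l μ (hR.2.1 j), Real.sqrt_sq (norm_nonneg _)]

theorem zero_mem_boundarySpace (ξ : V) (l : Set.Ioo (0 : ℝ) 1) :
    (0 : J.Charge) ∈ J.boundarySpace ξ l := fun R _ => ⟨0, by simp [Psi]⟩

theorem boundarySpace_mono (hJ : J.IsLocallyFinite) (ξ : V) {l m : Set.Ioo (0 : ℝ) 1}
    (h : (l : ℝ) ≤ m) : J.boundarySpace ξ l ⊆ J.boundarySpace ξ m := by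
  intro μ hμ
  rw [J.mem_boundarySpace_iff hJ] at hμ ⊢
  refine Summable.of_nonneg_of_le
    (fun a => mul_nonneg (J.weight_nonneg ξ m.2.1 m.2.2 a) (sq_nonneg _)) (fun a => ?_) hμ
  exact mul_le_mul_of_nonneg_right (J.weight_anti ξ l.2.1 h m.2.2 a) (sq_nonneg _)

/-! ### Trees of small growth -/

open Classical in
/-- If the edges have length at least `δ` and the number of vertices grows at most like
`exp (α N)`, then the boundary space is trivial for `l ^ (2 δ) exp α < 1`: by the Cauchy-Schwarz
inequality the total mass of the balls of level `N` tends to zero. -/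
theorem boundarySpace_eq_zero (hJ : J.IsLocallyFinite) (ξ : V) (l : Set.Ioo (0 : ℝ) 1)
    {δ α : ℝ} (hδ : 0 < δ) (hlen : ∀ e ∈ J.graph.edgeSet, δ ≤ J.length e)
    (hα : ∀ N : ℕ, (Set.ncard {a | J.graph.dist ξ a ≤ N} : ℝ) ≤ Real.exp (α * N))
    (hl : (l : ℝ) ^ (2 * δ) * Real.exp α < 1) : J.boundarySpace ξ l = {0} := by
  have hV := hJ.countable ξ
  have l0 : 0 < (l : ℝ) := l.2.1
  refine Set.eq_singleton_iff_unique_mem.2 ⟨J.zero_mem_boundarySpace ξ l, fun μ hμ => ?_⟩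
  rw [J.mem_boundarySpace_iff hJ] at hμ
  have hnn : ∀ a, 0 ≤ J.weight ξ l a * μ (J.ball (J.outerBranch ξ a)) ^ 2 := fun a =>
    mul_nonneg (J.weight_nonneg ξ l.2.1 l.2.2 a) (sq_nonneg _)
  set M := ∑' a, J.weight ξ l a * μ (J.ball (J.outerBranch ξ a)) ^ 2
  set q := (l : ℝ) ^ (2 * δ) with hq
  have hq0 : 0 < q := Real.rpow_pos_of_pos l0 _
  have hq1 : q < 1 := Real.rpow_lt_one l0.le l.2.2 (by linarith)
  -- the vertices of level `N`
  let F : ℕ → Finset V := fun N => (hJ.finite_level_le ξ N).toFinset.filter fun a => J.level ξ a = N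
  have hF : ∀ N a, a ∈ F N ↔ J.level ξ a = N := by
    intro N a
    simp only [F, Finset.mem_filter, Set.Finite.mem_toFinset, Set.mem_ofPred_eq]
    omega
  have hcard : ∀ N, ((F N).card : ℝ) ≤ Real.exp α ^ N := by
    intro N
    rw [← Real.exp_nat_mul, mul_comm]
    refine le_trans ?_ (hα N)
    have hfin : {a | J.graph.dist ξ a ≤ N}.Finite := by
      simpa only [level_eq_dist] using hJ.finite_level_le ξ N
    rw [← Set.ncard_coe_finset]
    refine Nat.cast_le.2 (Set.ncard_le_ncard (fun a ha => ?_) hfin)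
    have := (hF N a).1 ha
    rw [level_eq_dist] at this
    exact this.le
  have hrho : ∀ a, δ * J.level ξ a ≤ J.rho ξ a := by
    intro a
    induction hn : J.level ξ a generalizing a with
    | zero => simpa using J.rho_nonneg ξ a
    | succ n ih =>
      have ha : a ≠ ξ := by
        rintro rfl
        rw [level_self] at hn; omega
      have h1 := J.level_parent ha
      have h2 := ih (J.parent ξ a) (by omega)
      have h3 := hlen _ ((SimpleGraph.mem_edgeSet _).2 (J.parent_adj ha))
      rw [J.rho_parent ha]
      push_cast
      linarith
  have hw : ∀ N a, J.level ξ a = N → (1 - q) ≤ q ^ N * J.weight ξ l a := by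
    intro N a ha
    by_cases hξ : a = ξ
    · rw [hξ, level_self] at ha
      subst ha
      simp [hξ, weight, hq0.le]
    · rw [J.weight_eq l0 hξ, ← mul_assoc]
      have h3 := hlen _ ((SimpleGraph.mem_edgeSet _).2 (J.parent_adj hξ))
      have h4 : (l : ℝ) ^ (2 * J.length s(J.parent ξ a, a)) ≤ q :=
        Real.rpow_le_rpow_of_exponent_ge l0 l.2.2.le (by linarith)
      have h5 : 1 ≤ q ^ N * (l : ℝ) ^ (-2 * J.rho ξ a) := by
        rw [hq, ← Real.rpow_mul_natCast l0.le, ← Real.rpow_add l0]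
        apply Real.one_le_rpow_of_pos_of_le_one_of_nonpos l0 l.2.2.le
        have := hrho a
        rw [ha] at this
        linarith
      nlinarith
  have hsq : ∀ N, ∑ a ∈ F N, μ (J.ball (J.outerBranch ξ a)) ^ 2 ≤ q ^ N * (M / (1 - q)) := by
    intro N
    rw [← mul_div_assoc, le_div_iff₀ (by linarith), Finset.sum_mul]
    calc ∑ a ∈ F N, μ (J.ball (J.outerBranch ξ a)) ^ 2 * (1 - q)
        ≤ ∑ a ∈ F N, q ^ N * (J.weight ξ l a * μ (J.ball (J.outerBranch ξ a)) ^ 2) := by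
          refine Finset.sum_le_sum fun a ha => ?_
          have := mul_le_mul_of_nonneg_left (hw N a ((hF N a).1 ha))
            (sq_nonneg (μ (J.ball (J.outerBranch ξ a))))
          linarith
      _ ≤ q ^ N * M := by
          rw [← Finset.mul_sum]
          exact mul_le_mul_of_nonneg_left (hμ.sum_le_tsum _ fun a _ => hnn a) (by positivity)
  refine J.charge_eq_zero ξ fun a => ?_
  have hbound : ∀ N, J.level ξ a ≤ N →
      μ (J.ball (J.outerBranch ξ a)) ^ 2 ≤ (M / (1 - q)) * (q * Real.exp α) ^ N := by
    intro N hN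
    have hM0 : 0 ≤ M / (1 - q) := div_nonneg (tsum_nonneg hnn) (by linarith)
    set G := (F N).filter fun u => a ∈ (J.path ξ u).support
    rw [J.charge_ball_eq_sum μ G (fun u hu => (Finset.mem_filter.1 hu).2)]
    · calc (∑ u ∈ G, μ (J.ball (J.outerBranch ξ u))) ^ 2
          ≤ G.card * ∑ u ∈ G, μ (J.ball (J.outerBranch ξ u)) ^ 2 :=
            sq_sum_le_card_mul_sum_sq
        _ ≤ Real.exp α ^ N * (q ^ N * (M / (1 - q))) := by
            apply mul_le_mul
            · exact (Nat.cast_le.2 (Finset.card_le_card (Finset.filter_subset _ _))).trans (hcard N)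
            · exact (Finset.sum_le_sum_of_subset_of_nonneg (Finset.filter_subset _ _)
                fun _ _ _ => sq_nonneg _).trans (hsq N)
            · exact Finset.sum_nonneg fun _ _ => sq_nonneg _
            · positivity
        _ = _ := by rw [mul_pow]; ring
    · intro ω hω
      have hωN : ω ∈ J.ball (J.outerBranch ξ (J.rootRay ξ ω N)) := by
        rw [mem_ball_outerBranch, level_rootRay]
      refine ⟨J.rootRay ξ ω N, ⟨Finset.mem_filter.2 ⟨(hF N _).2 (J.level_rootRay ξ ω N),
        J.mem_path_of_mem_ball hω hωN (by rwa [level_rootRay])⟩, hωN⟩, ?_⟩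
      rintro u ⟨hu, hωu⟩
      rw [mem_ball_outerBranch, (hF N u).1 (Finset.mem_filter.1 hu).1] at hωu
      exact hωu.symm
  have hlim : Filter.Tendsto (fun N : ℕ => (M / (1 - q)) * (q * Real.exp α) ^ N)
      Filter.atTop (𝓝 0) := by
    simpa using (tendsto_pow_atTop_nhds_zero_of_lt_one (by positivity) hl).const_mul (M / (1 - q))
  have h0 := ge_of_tendsto hlim
    ((Filter.eventually_ge_atTop (J.level ξ a)).mono hbound)
  exact pow_eq_zero_iff (two_ne_zero) |>.1 (le_antisymm h0 (sq_nonneg _))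

/-! ### Charges carried by regular subtrees -/

/-- The descending sequence of vertices starting in `x` in which the step after `k` steps leads to
the `c k`-th of the children `g v` of the present vertex `v`. -/
def descend {p : ℕ} (g : V → Fin p → V) (x : V) (c : ℕ → Fin p) : ℕ → V
  | 0 => x
  | k + 1 => g (descend g x c k) (c k)

theorem measurable_descend [Countable V] [MeasurableSpace V] [DiscreteMeasurableSpace V] {p : ℕ}
    (g : V → Fin p → V) (x : V) (k : ℕ) : Measurable fun c => descend g x c k := by
  induction k with
  | zero => exact measurable_const
  | succ k ih =>
    exact (Measurable.of_discrete (f := Function.uncurry g)).comp (ih.prodMk (measurable_pi_apply k))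

/-- The children structure needed for the construction of a charge: every vertex of `I` has (at
least) `p` children in `I`, joined to it by edges of length at most `τ`. -/
def HasChildren (ξ : V) (I : Set V) (p : ℕ) (τ : ℝ) : Prop :=
  ∀ x ∈ I, ∃ g : Fin p → V, Function.Injective g ∧
    ∀ i, g i ∈ I ∧ g i ≠ ξ ∧ J.parent ξ (g i) = x ∧ J.length s(x, g i) ≤ τ

/-- The distribution of the random ray from `x` that chooses independently and uniformly one of `p`
children in each step. The truncated differences of levels are `0` for the vertices of level at
most that of `x`: among those the ray from `ξ` passes only the ones on the way from `ξ` to `x`. -/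
theorem HasChildren.exists_measure [Countable V] {J : MetricTree V} {ξ : V} {I : Set V} {p : ℕ}
    {τ : ℝ} (hI : J.HasChildren ξ I p τ) (hp : 0 < p) {x : V} (hx : x ∈ I) :
    ∃ ν : MeasureTheory.Measure J.Abs, MeasureTheory.IsProbabilityMeasure ν ∧
      (∀ a, ν.real (J.ball (J.outerBranch ξ a)) ≤ (1 / (p : ℝ)) ^ (J.level ξ a - J.level ξ x)) ∧
      ∀ a, ν.real (J.ball (J.outerBranch ξ a)) ≠ 0 →
        J.rho ξ a ≤ J.rho ξ x + τ * (J.level ξ a - J.level ξ x : ℕ) := by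
  classical
  have : Nonempty (Fin p) := ⟨⟨0, hp⟩⟩
  choose! g hginj hg using hI
  set X : (ℕ → Fin p) → ℕ → V := descend g x with hX
  have hXI : ∀ c k, X c k ∈ I := by
    intro c k
    induction k with
    | zero => exact hx
    | succ k ih => exact (hg _ ih (c k)).1
  have hout : ∀ c, J.IsOutward ξ (X c) := fun c k => (hg _ (hXI c k) (c k)).2.imp_right And.left
  have hrho : ∀ c k, J.rho ξ (X c k) ≤ J.rho ξ x + τ * k := by
    intro c k
    induction k with
    | zero => simp [hX, descend]
    | succ k ih =>
      have h1 := J.rho_parent (hout c k).1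
      have h2 : J.length s(X c k, X c (k + 1)) ≤ τ := (hg _ (hXI c k) (c k)).2.2.2
      rw [(hout c k).2] at h1
      push_cast
      linarith
  set n₀ := J.level ξ x
  let Φ : (ℕ → Fin p) → J.Abs := fun c => Quotient.mk J.raySetoid (hout c).toRay
  have hroot : ∀ c k, J.rootRay ξ (Φ c) (n₀ + k) = X c k := fun c k =>
    J.rootRay_mk (hout c).toRay (hout c) k
  have hroot' : ∀ c n, J.rootRay ξ (Φ c) n = (J.parent ξ)^[n₀] (X c n) := by
    intro c n
    rw [← (J.rootRay_isOutward ξ (Φ c)).iterate_parent n n₀, add_comm n, hroot]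
  have hmeas : Measurable Φ := by
    have h : @Measurable _ _ _ (MeasurableSpace.generateFrom
        (Set.range fun u => J.ball (J.outerBranch ξ u))) Φ := by
      refine measurable_generateFrom ?_
      rintro _ ⟨a, rfl⟩
      have hset : Φ ⁻¹' J.ball (J.outerBranch ξ a) =
          {c | (J.parent ξ)^[n₀] (X c (J.level ξ a)) = a} := by
        ext c
        rw [Set.mem_preimage, mem_ball_outerBranch, hroot']
        rfl
      rw [hset]
      let _ : MeasurableSpace V := ⊤
      have _ : DiscreteMeasurableSpace V := ⟨fun _ => trivial⟩
      exact (Measurable.of_discrete (f := (J.parent ξ)^[n₀])).comp (measurable_descend g x _)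
        (MeasurableSet.of_discrete (s := {a}))
    rw [← J.borel_eq_generateFrom_ball ξ] at h
    exact h
  let P : MeasureTheory.Measure (ℕ → Fin p) :=
    MeasureTheory.Measure.infinitePi fun _ => (PMF.uniformOfFintype (Fin p)).toMeasure
  have hν : ∀ a, (P.map Φ).real (J.ball (J.outerBranch ξ a)) =
      P.real {c | J.rootRay ξ (Φ c) (J.level ξ a) = a} := by
    intro a
    rw [MeasureTheory.map_measureReal_apply hmeas (J.measurableSet_ball_outerBranch ξ a)]
    congr 1
    ext c
    exact J.mem_ball_outerBranch
  refine ⟨P.map Φ, MeasureTheory.Measure.isProbabilityMeasure_map hmeas.aemeasurable,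
    fun a => ?_, fun a ha => ?_⟩
  · rw [hν]
    set k := J.level ξ a - n₀ with hk
    by_cases hne : ∃ c₀, J.rootRay ξ (Φ c₀) (J.level ξ a) = a
    · obtain ⟨c₀, hc₀⟩ := hne
      -- the choices leading to `a` are determined by `a`
      have hsub : {c | J.rootRay ξ (Φ c) (J.level ξ a) = a} ⊆
          Set.pi (Finset.range k) fun i => {c₀ i} := by
        intro c hc i hi
        have hi' : i < k := Finset.mem_range.1 hi
        have hle : n₀ + k = J.level ξ a := by omega
        have hXk : X c k = X c₀ k := by
          rw [← hroot, ← hroot, hle, hc₀]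
          exact hc
        have hback : ∀ j, j ≤ k → X c j = X c₀ j := by
          intro j hj
          rw [← (hout c).iterate_parent j (k - j), ← (hout c₀).iterate_parent j (k - j),
            Nat.add_sub_cancel' hj, hXk]
        have h1 : g (X c i) (c i) = g (X c₀ i) (c₀ i) := hback (i + 1) hi'
        rw [hback i hi'.le] at h1
        exact hginj _ (hXI c₀ i) h1
      refine (MeasureTheory.measureReal_mono hsub).trans_eq ?_
      rw [MeasureTheory.measureReal_def, MeasureTheory.Measure.infinitePi_pi]
      · simp
      · exact fun i _ => measurableSet_singleton _
    · have : {c | J.rootRay ξ (Φ c) (J.level ξ a) = a} = ∅ :=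
        Set.eq_empty_of_forall_notMem fun c hc => hne ⟨c, hc⟩
      rw [this, MeasureTheory.measureReal_empty]
      positivity
  · rw [hν] at ha
    obtain ⟨c, hc⟩ := MeasureTheory.nonempty_of_measureReal_ne_zero ha
    have hc' : J.rootRay ξ (Φ c) (J.level ξ a) = a := hc
    rcases le_total n₀ (J.level ξ a) with h | h
    · rw [← Nat.add_sub_cancel' h, hroot] at hc'
      nth_rewrite 1 [← hc']
      exact hrho c _
    · have hmem : a ∈ (J.path ξ x).support := by
        rw [show x = J.rootRay ξ (Φ c) n₀ from (hroot c 0).symm]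
        exact J.rootRay_mem_outerBranch.2 ⟨h, hc'⟩
      have hmono : ∀ y, a ∈ (J.path ξ y).support → J.rho ξ a ≤ J.rho ξ y := by
        intro y hy
        rw [← J.iterate_of_mem_path hy]
        generalize J.level ξ y - J.level ξ a = m
        induction m with
        | zero => simp
        | succ m ih =>
          rw [Function.iterate_succ_apply']
          by_cases hm : (J.parent ξ)^[m] y = ξ
          · rw [hm] at ih
            rwa [hm, parent_self]
          · have := J.rho_parent hm
            have := J.length_parent_pos hm
            linarith
      rw [Nat.sub_eq_zero_of_le h]
      simpa using hmono x hmem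

/-- The charge of the random ray belongs to the boundary space as soon as its number of choices
outweighs the growth of the weights: the masses of the balls of a given level add up to at most
`1`, so that the contributions of the levels are dominated by a geometric series. -/
theorem HasChildren.boundarySpace_ne {J : MetricTree V} (hJ : J.IsLocallyFinite) {ξ : V}
    {I : Set V} {p : ℕ} {τ : ℝ} (hI : J.HasChildren ξ I p τ) {x : V} (hx : x ∈ I)
    (l : Set.Ioo (0 : ℝ) 1) (hl : (l : ℝ) ^ (-2 * τ) < p) : J.boundarySpace ξ l ≠ {0} := by
  classical
  have hV := hJ.countable ξ
  have l0 : 0 < (l : ℝ) := l.2.1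
  set t := (l : ℝ) ^ (-2 * τ) with ht
  have ht0 : 0 < t := Real.rpow_pos_of_pos l0 _
  have hp0 : (0 : ℝ) < p := ht0.trans hl
  obtain ⟨ν, hν, hle, hrho⟩ := hI.exists_measure (Nat.cast_pos.1 hp0) hx
  have hball : ∀ a, ν.toSignedMeasure (J.ball (J.outerBranch ξ a)) =
      ν.real (J.ball (J.outerBranch ξ a)) := fun a =>
    MeasureTheory.Measure.toSignedMeasure_apply_measurable (J.measurableSet_ball_outerBranch ξ a)
  have hmem : ν.toSignedMeasure ∈ J.boundarySpace ξ l := by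
    rw [J.mem_boundarySpace_iff hJ]
    simp only [hball]
    set m : V → ℝ := fun a => ν.real (J.ball (J.outerBranch ξ a)) with hm
    have hm0 : ∀ a, 0 ≤ m a := fun a => MeasureTheory.measureReal_nonneg
    set n₀ := J.level ξ x
    set A := (l : ℝ) ^ (-2 * J.rho ξ x) with hA
    have hA0 : 0 < A := Real.rpow_pos_of_pos l0 _
    have hterm : ∀ a, J.weight ξ l a * m a ^ 2 ≤ A * (t / p) ^ (J.level ξ a - n₀) * m a := by
      intro a
      by_cases h0 : m a = 0
      · simp [h0]
      · have h1 := hrho a h0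
        have h2 : (l : ℝ) ^ (-2 * J.rho ξ a) ≤ A * t ^ (J.level ξ a - n₀) := by
          rw [hA, ht, ← Real.rpow_mul_natCast l0.le, ← Real.rpow_add l0]
          apply Real.rpow_le_rpow_of_exponent_ge l0 l.2.2.le
          linarith
        have h3 := mul_le_mul ((J.weight_le ξ l0 a).trans h2) (hle a) (hm0 a) (by positivity)
        have h4 := mul_le_mul_of_nonneg_right h3 (hm0 a)
        calc J.weight ξ l a * m a ^ 2 = J.weight ξ l a * m a * m a := by ring
          _ ≤ _ := h4
          _ = _ := by rw [div_pow, div_pow, one_pow]; ring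
    have hq0 : 0 ≤ t / p := by positivity
    have hq1 : t / p < 1 := (div_lt_one hp0).2 hl
    have hsumb : Summable fun n : ℕ => A * (t / p) ^ (n - n₀) := by
      refine Summable.mul_left _ ((summable_nat_add_iff n₀).1 ?_)
      simpa using summable_geometric_of_lt_one hq0 hq1
    have hlevel : ∀ (F : Finset V) (n : ℕ), ∑ a ∈ F with J.level ξ a = n, m a ≤ 1 := by
      intro F n
      rw [hm, ← MeasureTheory.measureReal_biUnion_finset]
      · exact MeasureTheory.measureReal_le_one
      · intro a ha b hb hab
        refine Set.disjoint_left.2 fun ω h1 h2 => hab ?_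
        rw [mem_ball_outerBranch] at h1 h2
        rw [← h1, ← h2, (Finset.mem_filter.1 ha).2, (Finset.mem_filter.1 hb).2]
      · exact fun a _ => J.measurableSet_ball_outerBranch ξ a
    refine summable_of_sum_le
      (fun a => mul_nonneg (J.weight_nonneg ξ l0 l.2.2 a) (sq_nonneg _))
      (c := ∑' n : ℕ, A * (t / p) ^ (n - n₀)) fun F => ?_
    calc ∑ a ∈ F, J.weight ξ l a * m a ^ 2
        ≤ ∑ a ∈ F, A * (t / p) ^ (J.level ξ a - n₀) * m a := Finset.sum_le_sum fun a _ => hterm a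
      _ = ∑ n ∈ F.image (J.level ξ), ∑ a ∈ F with J.level ξ a = n,
            A * (t / p) ^ (J.level ξ a - n₀) * m a :=
          (Finset.sum_fiberwise_of_maps_to (fun a ha => Finset.mem_image_of_mem _ ha) _).symm
      _ ≤ ∑ n ∈ F.image (J.level ξ), A * (t / p) ^ (n - n₀) := by
          refine Finset.sum_le_sum fun n _ => ?_
          rw [Finset.sum_congr rfl fun a ha => by rw [(Finset.mem_filter.1 ha).2], ← Finset.mul_sum]
          exact mul_le_of_le_one_right (by positivity) (hlevel F n)
      _ ≤ _ := hsumb.sum_le_tsum _ fun n _ => by positivity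
  intro h
  rw [h, Set.mem_singleton_iff] at hmem
  have h1 := hball ξ
  rw [hmem, ball_outerBranch_self, MeasureTheory.probReal_univ] at h1
  simp at h1

/-- In a subtree whose vertices have at least `p + 1` neighbours, every vertex has `p` children, as
at most one of its neighbours is its parent. -/
theorem hasChildren_of_encard {ξ : V} {I : Set V} {p : ℕ} {τ : ℝ}
    (hI : ∀ a ∈ I, (p : ℕ∞) + 1 ≤ {b | b ∈ I ∧ J.graph.Adj a b}.encard)
    (hτ : ∀ a ∈ I, ∀ b ∈ I, J.graph.Adj a b → J.length s(a, b) ≤ τ) : J.HasChildren ξ I p τ := by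
  intro x hx
  set N := {b | b ∈ I ∧ J.graph.Adj x b}
  have h1 : (p : ℕ∞) ≤ (N \ {J.parent ξ x}).encard := by
    have h2 := (hI x hx).trans (Set.encard_le_encard_sdiff_add_encard N {J.parent ξ x})
    rw [Set.encard_singleton] at h2
    exact (WithTop.add_le_add_iff_right WithTop.one_ne_top).1 h2
  obtain ⟨T, hT, hTp⟩ := Set.exists_subset_encard_eq h1
  have hTfin : T.Finite := Set.finite_of_encard_eq_coe hTp
  have hcard : hTfin.toFinset.card = p := by
    rw [hTfin.encard_eq_coe_toFinset_card] at hTp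
    exact_mod_cast hTp
  let φ := (hTfin.toFinset.equivFinOfCardEq hcard).symm
  refine ⟨fun i => (φ i : V), fun i j hij => φ.injective (Subtype.ext hij), fun i => ?_⟩
  obtain ⟨⟨hbI, hxb⟩, hbp⟩ := hT (hTfin.mem_toFinset.1 (φ i).2)
  rcases J.parent_cases ξ hxb with h | h
  · refine ⟨hbI, ?_, h.1, hτ x hx _ hbI hxb⟩
    intro h0
    change (φ i : V) = ξ at h0
    have := h.2
    rw [h0, level_self] at this
    omega
  · exact absurd h.1.symm hbp

/-! ### The critical parameter -/

/-- The infimum of the parameters with a nontrivial boundary space, or `1` if there are none. -/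
noncomputable def criticalParameter (ξ : V) : ℝ :=
  sInf (insert 1 {x : ℝ | ∃ l : Set.Ioo (0 : ℝ) 1, (l : ℝ) = x ∧ J.boundarySpace ξ l ≠ {0}})

theorem criticalParameter_le_of_ne {ξ : V} {l : Set.Ioo (0 : ℝ) 1}
    (h : J.boundarySpace ξ l ≠ {0}) : J.criticalParameter ξ ≤ l := by
  refine csInf_le ⟨0, ?_⟩ (Or.inr ⟨l, rfl, h⟩)
  rintro x (rfl | ⟨m, rfl, -⟩)
  · exact zero_le_one
  · exact m.2.1.le

theorem criticalParameter_le_one (ξ : V) : J.criticalParameter ξ ≤ 1 := by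
  refine csInf_le ⟨0, ?_⟩ (Or.inl rfl)
  rintro x (rfl | ⟨m, rfl, -⟩)
  · exact zero_le_one
  · exact m.2.1.le

theorem le_criticalParameter {ξ : V} {x : ℝ} (hx : x ≤ 1)
    (h : ∀ l : Set.Ioo (0 : ℝ) 1, (l : ℝ) < x → J.boundarySpace ξ l = {0}) :
    x ≤ J.criticalParameter ξ := by
  refine le_csInf ⟨1, Or.inl rfl⟩ ?_
  rintro y (rfl | ⟨m, rfl, hm⟩)
  · exact hx
  · exact not_lt.1 fun hlt => hm (h m hlt)

theorem boundarySpace_ne_of_criticalParameter_lt (hJ : J.IsLocallyFinite) {ξ : V}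
    {l : Set.Ioo (0 : ℝ) 1} (h : J.criticalParameter ξ < l) : J.boundarySpace ξ l ≠ {0} := by
  obtain ⟨y, rfl | ⟨m, rfl, hm⟩, hy⟩ := exists_lt_of_csInf_lt (Set.insert_nonempty _ _) h
  · exact absurd l.2.2 hy.not_gt
  · intro hl
    refine hm (Set.eq_singleton_iff_unique_mem.2 ⟨J.zero_mem_boundarySpace ξ m, fun μ hμ => ?_⟩)
    have := J.boundarySpace_mono hJ ξ hy.le hμ
    rwa [hl] at this

theorem HasChildren.criticalParameter_le {J : MetricTree V} (hJ : J.IsLocallyFinite) {ξ : V}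
    {I : Set V} {p : ℕ} {τ : ℝ} (hI : J.HasChildren ξ I p τ) {x : V} (hx : x ∈ I) (hp : 1 ≤ p)
    (hτ : 0 < τ) : J.criticalParameter ξ ≤ 1 / (p : ℝ) ^ (1 / (2 * τ)) := by
  by_contra! hlt
  obtain ⟨l, hl1, hl2⟩ := exists_between hlt
  have hp0 : (0 : ℝ) < p := by exact_mod_cast hp
  have hpt : 0 < (p : ℝ) ^ (1 / (2 * τ)) := Real.rpow_pos_of_pos hp0 _
  have l0 : 0 < l := (by positivity : 0 < 1 / (p : ℝ) ^ (1 / (2 * τ))).trans hl1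
  refine absurd (J.criticalParameter_le_of_ne
    (l := ⟨l, l0, hl2.trans_le (J.criticalParameter_le_one ξ)⟩) ?_) hl2.not_ge
  refine hI.boundarySpace_ne hJ hx _ ?_
  change l ^ (-2 * τ) < p
  have h1 : l⁻¹ < (p : ℝ) ^ (1 / (2 * τ)) := by
    rw [one_div] at hl1
    exact inv_lt_of_inv_lt₀ hpt hl1
  have h2 := Real.rpow_lt_rpow (by positivity) h1 (show 0 < 2 * τ by linarith)
  rw [← Real.rpow_mul hp0.le, one_div_mul_cancel (by linarith), Real.rpow_one,
    Real.inv_rpow l0.le, ← Real.rpow_neg l0.le] at h2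
  rwa [neg_mul]

end MetricTree

theorem theorem5p3 {V : Type*} (J : MetricTree V) (hJfin : J.IsLocallyFinite)
    (hJperf : J.IsPerfect) (ξ : V) :
    ∃ σ : ℝ, 0 ≤ σ ∧ σ ≤ 1 ∧
      (∀ l : Set.Ioo (0 : ℝ) 1, (l : ℝ) < σ → J.boundarySpace ξ l = {0}) ∧
      (∀ l : Set.Ioo (0 : ℝ) 1, σ < (l : ℝ) → J.boundarySpace ξ l ≠ {0}) ∧
      ((∃ L : ℝ, ∀ e ∈ J.graph.edgeSet, J.length e ≤ L) → σ < 1) ∧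
      (∀ (p : ℕ) (τ : ℝ) (I : Set V), 1 ≤ p → IsBruhatTitsTree p (J.graph.induce I) →
        (∀ a ∈ I, ∀ b ∈ I, J.graph.Adj a b → J.length s(a, b) ≤ τ) →
        σ ≤ 1 / (p : ℝ) ^ (1 / (2 * τ))) ∧
      ((∃ δ : ℝ, 0 < δ ∧ ∀ e ∈ J.graph.edgeSet, δ ≤ J.length e) →
        (∃ α : ℝ, ∀ N : ℕ, (Set.ncard {a | J.graph.dist ξ a ≤ N} : ℝ) ≤ Real.exp (α * N)) →
        0 < σ) := by
  refine ⟨J.criticalParameter ξ, ?_, J.criticalParameter_le_one ξ, fun l hl => ?_,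
    fun l hl => J.boundarySpace_ne_of_criticalParameter_lt hJfin hl, ?_, ?_, ?_⟩
  · exact J.le_criticalParameter zero_le_one fun l hl => absurd l.2.1 hl.not_gt
  · by_contra h
    exact hl.not_ge (J.criticalParameter_le_of_ne h)
  · rintro ⟨L, hL⟩
    have hnbr : (J.graph.neighborSet ξ).Nonempty := by
      rw [← Set.encard_pos]
      exact lt_of_lt_of_le (by norm_num) (hJperf ξ)
    obtain ⟨b, hb⟩ := hnbr
    have hb' : s(ξ, b) ∈ J.graph.edgeSet := hb
    have hL0 : 0 < L := (J.length_pos _ hb').trans_le (hL _ hb')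
    -- a perfect tree branches at least binarily
    have hchild : J.HasChildren ξ Set.univ 2 L := by
      refine J.hasChildren_of_encard (fun a _ => ?_) fun a _ b _ hab => hL s(a, b) hab
      have h := hJperf a
      have hset : {b | b ∈ Set.univ ∧ J.graph.Adj a b} = J.graph.neighborSet a := by
        ext b
        simp
      rw [hset]
      exact le_trans (by norm_num) h
    refine (hchild.criticalParameter_le hJfin (Set.mem_univ ξ) one_le_two hL0).trans_lt ?_
    rw [div_lt_one (by positivity)]
    exact Real.one_lt_rpow (by norm_num) (by positivity)
  · intro p τ I hp hI hτ
    have hcard : ∀ a (ha : a ∈ I), {b | b ∈ I ∧ J.graph.Adj a b}.encard = p + 1 := by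
      intro a ha
      rw [← hI.2 ⟨a, ha⟩, ← Subtype.val_injective.encard_image]
      congr 1
      ext b
      simp [and_comm]
    obtain ⟨x, hx⟩ := hI.1.connected.nonempty
    obtain ⟨b, hbI, hb⟩ : {b | b ∈ I ∧ J.graph.Adj x b}.Nonempty := by
      rw [← Set.encard_pos, hcard x hx]
      positivity
    have hτ0 : 0 < τ := (J.length_pos s(x, b) hb).trans_le (hτ x hx b hbI hb)
    exact (J.hasChildren_of_encard (fun a ha => (hcard a ha).ge) hτ).criticalParameter_le
      hJfin hx hp hτ0
  · rintro ⟨δ, hδ, hlen⟩ ⟨α, hα⟩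
    -- `x` solves `x ^ (2 δ) exp |α| = 1`
    set x : ℝ := Real.exp (-|α| / (2 * δ)) with hx
    have hx0 : 0 < x := Real.exp_pos _
    refine hx0.trans_le (J.le_criticalParameter ?_ fun l hl => ?_)
    · rw [hx, Real.exp_le_one_iff]
      exact div_nonpos_of_nonpos_of_nonneg (neg_nonpos.2 (abs_nonneg α)) (by linarith)
    · refine J.boundarySpace_eq_zero hJfin ξ l hδ hlen hα ?_
      have h1 : (l : ℝ) ^ (2 * δ) < x ^ (2 * δ) :=
        Real.rpow_lt_rpow l.2.1.le hl (by linarith)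
      have h2 : x ^ (2 * δ) = Real.exp (-|α|) := by
        rw [hx, ← Real.exp_mul, div_mul_cancel₀ _ (by linarith)]
      calc (l : ℝ) ^ (2 * δ) * Real.exp α < Real.exp (-|α|) * Real.exp α :=
            mul_lt_mul_of_pos_right (h2 ▸ h1) (Real.exp_pos _)
        _ = Real.exp (-|α| + α) := (Real.exp_add _ _).symm
        _ ≤ 1 := Real.exp_le_one_iff.2 (by linarith [le_abs_self α])
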